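/- Let $k$ be a commutative artinian ring and let $(\mathcal{C},\mathbb{E},\mathfrak{s})$ be a $k$-linear extriangulated category (in the sense of Nakaoka–Palu) which is Ext-finite (each $\mathbb{E}(A,B)$ is a finitely generated $k$-module) and Krull–Schmidt (each object is a finite direct sum of objects with local endomorphism rings). Assume the WIC condition: for all composable morphisms $f\colon A\to B$ and $g\colon B\to C$, if $g\circ f$ is an $\mathfrak{s}$-inflation then so is $f$, and if $g\circ f$ is an $\mathfrak{s}$-deflation then so is $g$. A morphism $f\colon X\to Y$ is *right $C$-determined* if every $g\colon T\to Y$, such that $g\circ h$ factors through $f$ for all $h\colon C\to T$, itself factors through $f$. A *right minimal version* of $f\colon X\to Y$ is a morphism $f'\colon X'\to Y$ such that $f$ and $f'$ factor through each other and every $g\in\operatorname{End}(X')$ with $f'\circ g=f'$ is an automorphism. An *intrinsic weak kernel* of an $\mathfrak{s}$-deflation $f$ is an object $K$ for which there is an $\mathfrak{s}$-triangle $K\to X'\xrightarrow{f'}Y\dashrightarrow$ with $f'$ a right minimal version of $f$. Call a morphism $f$ *$\mathfrak{s}$-projective* if $\mathbb{E}(f,A)=0$ for all $A\in\mathcal{C}$,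 let $\underline{\mathcal{C}}$ be the quotient of $\mathcal{C}$ by the ideal of $\mathfrak{s}$-projective morphisms, and let $D=\operatorname{Hom}_k(-,\check{k})$, where $\check{k}$ is the minimal injective cogenerator for the category of finitely generated $k$-modules. Let $\mathcal{C}_l$ be the full subcategory of those $X\in\mathcal{C}$ for which the functor $D\mathbb{E}(-,X)\colon\underline{\mathcal{C}}\to k\text{-mod}$ is representable, i.e. isomorphic to $\underline{\mathcal{C}}(W,-)$ for some object $W$. **Theorem.** Let $\alpha\colon X\to Y$ be an $\mathfrak{s}$-deflation in $\mathcal{C}$. Then $\alpha$ has an intrinsic weak kernel, and for every intrinsic weak kernel $K$ of $\alpha$ the following are equivalent: 1. $\alpha$ is right $C$-determined for some object $C\in\mathcal{C}$. 2. $K$ lies in $\mathcal{C}_l$. -/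

import Mathlib

open CategoryTheory CategoryTheory.Limits Opposite

universe w v u u₀

namespace Extri

/-! ### The minimal injective cogenerator of a commutative ring -/

section Cogenerator

/-- `J` is an injective cogenerator for `k`-modules, and no proper submodule of `J` is one.
(Over an artinian ring such a `J` is finitely generated, and it is the injective hull of the
direct sum of the simple modules, one from each isomorphism class.) -/
structure IsMinimalInjectiveCogenerator (k : Type u₀) [CommRing k] (J : Type u₀)
    [AddCommGroup J] [Module k J] : Prop where
  injective : Module.Injective k J
  cogenerator : ∀ (M : Type u₀) [AddCommGroup M] [Module k M] (x : M), x ≠ 0 →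
    ∃ f : M →ₗ[k] J, f x ≠ 0
  minimal : ∀ N : Submodule k J, Module.Injective k N →
    (∀ (M : Type u₀) [AddCommGroup M] [Module k M] (x : M), x ≠ 0 →
      ∃ f : M →ₗ[k] N, f x ≠ 0) → N = ⊤

/-- `T` is an essential extension of `S` inside `Q`. -/
def EssentialIn {k Q : Type u₀} [CommRing k] [AddCommGroup Q] [Module k Q]
    (S T : Submodule k Q) : Prop :=
  S ≤ T ∧ ∀ x ∈ T, x ≠ 0 → ∃ r : k, r • x ∈ S ∧ r • x ≠ 0

theorem exists_injective_essential {k Q : Type u₀} [CommRing k] [AddCommGroup Q] [Module k Q]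
    (hQ : Module.Injective k Q) (S : Submodule k Q) :
    ∃ T : Submodule k Q, EssentialIn S T ∧ Module.Injective k T := by
  obtain ⟨T, -, hT⟩ := zorn_le_nonempty₀ {T : Submodule k Q | EssentialIn S T} (by
    intro c hc hchain y hy
    refine ⟨sSup c, ⟨(hc hy).1.trans (le_sSup hy), ?_⟩, fun z hz => le_sSup hz⟩
    intro x hx hx0
    obtain ⟨z, hz, hxz⟩ := (Submodule.mem_sSup_of_directed ⟨y, hy⟩ hchain.directedOn).1 hx
    exact (hc hz).2 x hxz hx0) S ⟨le_rfl, fun x hx h0 => ⟨1, by simpa using hx, by simpa using h0⟩⟩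
  have hTe : EssentialIn S T := hT.prop
  obtain ⟨D, -, hD⟩ := zorn_le_nonempty₀ {D : Submodule k Q | Disjoint D T} (by
    intro c hc hchain y hy
    refine ⟨sSup c, ?_, fun z hz => le_sSup hz⟩
    refine Submodule.disjoint_def.2 fun x hx hxT => ?_
    obtain ⟨z, hz, hxz⟩ := (Submodule.mem_sSup_of_directed ⟨y, hy⟩ hchain.directedOn).1 hx
    exact Submodule.disjoint_def.1 (hc hz) x hxz hxT) ⊥ disjoint_bot_left
  have hDT : Disjoint D T := hD.prop
  have key : ∀ x, x ∉ D → ∃ d ∈ D, ∃ r : k, d + r • x ∈ T ∧ d + r • x ≠ 0 := by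
    intro x hx
    by_contra! hcon
    refine hx ?_
    have hdis : Disjoint (D ⊔ Submodule.span k {x}) T := by
      refine Submodule.disjoint_def.2 fun y hy hyT => ?_
      obtain ⟨d, hd, z, hz, rfl⟩ := Submodule.mem_sup.1 hy
      obtain ⟨r, rfl⟩ := Submodule.mem_span_singleton.1 hz
      exact hcon d hd r hyT
    have := hD.le_of_ge hdis le_sup_left
    exact this (Submodule.mem_sup_right (Submodule.mem_span_singleton_self x))
  have hinj : Function.Injective (D.mkQ ∘ₗ T.subtype) := by
    rw [← LinearMap.ker_eq_bot, LinearMap.ker_eq_bot']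
    intro t ht
    have h1 : (t : Q) ∈ D := by simpa using ht
    exact Subtype.ext (Submodule.disjoint_def.1 hDT t h1 t.2)
  obtain ⟨g, hg⟩ := hQ.out (D.mkQ ∘ₗ T.subtype) hinj T.subtype
  have hgT : ∀ t ∈ T, g (D.mkQ t) = t := fun t ht => hg ⟨t, ht⟩
  have hgD : ∀ d ∈ D, g (D.mkQ d) = 0 := fun d hd => by
    have : D.mkQ d = 0 := by simpa using hd
    rw [this, map_zero]
  have hle : T ≤ LinearMap.range g := fun t ht => ⟨_, hgT t ht⟩
  have hess : EssentialIn S (LinearMap.range g) := by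
    refine ⟨hTe.1.trans hle, ?_⟩
    rintro _ ⟨q, rfl⟩ h0
    obtain ⟨x, rfl⟩ := D.mkQ_surjective q
    have hx : x ∉ D := fun h => h0 (hgD x h)
    obtain ⟨d, hd, r, hrT, hr0⟩ := key x hx
    obtain ⟨r', h1, h2⟩ := hTe.2 _ hrT hr0
    have e : d + r • x = r • g (D.mkQ x) := by
      rw [← hgT _ hrT, map_add, map_add, hgD d hd, zero_add, map_smul, map_smul]
    rw [e] at h1 h2
    exact ⟨r' * r, by simpa [mul_smul] using h1, by simpa [mul_smul] using h2⟩
  have hrange : LinearMap.range g ≤ T := hT.le_of_ge hess hle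
  refine ⟨T, hTe, ⟨fun X Y _ _ _ _ f hf a => ?_⟩⟩
  obtain ⟨h, hh⟩ := hQ.out f hf (T.subtype ∘ₗ a)
  refine ⟨LinearMap.codRestrict T (g ∘ₗ D.mkQ ∘ₗ h) fun y => hrange ⟨_, rfl⟩, fun x => ?_⟩
  apply Subtype.ext
  simp only [LinearMap.codRestrict_apply, LinearMap.comp_apply, hh]
  exact hgT _ (a x).2

theorem exists_minimalInjectiveCogenerator (k : Type u₀) [CommRing k] :
    ∃ J : ModuleCat.{u₀} k, IsMinimalInjectiveCogenerator k J := by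
  classical
  let S₀ := Π₀ m : MaximalSpectrum k, k ⧸ m.asIdeal
  let Q := Injective.under (ModuleCat.of k S₀)
  let ι : S₀ →ₗ[k] Q := (Injective.ι (ModuleCat.of k S₀)).hom
  have hι : Function.Injective ι :=
    (ModuleCat.mono_iff_injective (Injective.ι (ModuleCat.of k S₀))).1 inferInstance
  have hQ : Module.Injective k Q :=
    (Module.injective_iff_injective_object k Q).2 (inferInstance : Injective Q)
  obtain ⟨T, hT, hTinj⟩ := exists_injective_essential hQ (LinearMap.range ι)
  refine ⟨ModuleCat.of k T, hTinj, ?_, ?_⟩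
  · intro M _ _ x hx
    have hne : LinearMap.ker (LinearMap.toSpanSingleton k M x) ≠ ⊤ := by
      intro h
      have : (1 : k) ∈ LinearMap.ker (LinearMap.toSpanSingleton k M x) := h ▸ Submodule.mem_top
      exact hx (by simpa using this)
    obtain ⟨m, hm, hle⟩ := Ideal.exists_le_maximal _ hne
    let a : (k ⧸ LinearMap.ker (LinearMap.toSpanSingleton k M x)) →ₗ[k] T :=
      LinearMap.codRestrict T
        (ι ∘ₗ DFinsupp.lsingle (R := k) (M := fun m : MaximalSpectrum k => k ⧸ m.asIdeal) ⟨m, hm⟩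
          ∘ₗ Submodule.factor hle) fun y => hT.1 ⟨_, rfl⟩
    let i : (k ⧸ LinearMap.ker (LinearMap.toSpanSingleton k M x)) →ₗ[k] M :=
      Submodule.liftQ _ (LinearMap.toSpanSingleton k M x) le_rfl
    have hi : Function.Injective i := LinearMap.ker_eq_bot.1 (Submodule.ker_liftQ_eq_bot _ _ _ le_rfl)
    obtain ⟨f, hf⟩ := hTinj.out i hi a
    refine ⟨f, fun h0 => ?_⟩
    have hx1 : i (Submodule.Quotient.mk 1) = x := by
      change LinearMap.toSpanSingleton k M x 1 = x
      simp
    rw [← hx1, hf] at h0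
    have h1 := congrArg Subtype.val h0
    have h2 : ι (DFinsupp.lsingle (R := k) (M := fun m : MaximalSpectrum k => k ⧸ m.asIdeal)
        ⟨m, hm⟩ (Submodule.Quotient.mk 1)) = 0 := h1
    have h3 := hι (h2.trans (map_zero ι).symm)
    have h4 : (Submodule.Quotient.mk 1 : k ⧸ m) = 0 := by
      have := DFunLike.congr_fun h3 (⟨m, hm⟩ : MaximalSpectrum k)
      rw [DFinsupp.lsingle_apply, DFinsupp.single_eq_same] at this
      exact this
    exact hm.ne_top ((Ideal.eq_top_iff_one m).2 ((Submodule.Quotient.mk_eq_zero m).1 h4))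
  · intro N hN hcog
    change Submodule k T at N
    have hsingle : ∀ (m : MaximalSpectrum k) (a : k ⧸ m.asIdeal),
        ∃ n ∈ N, (n : Q) = ι (DFinsupp.single m a) := by
      intro m a
      have h1 : (Submodule.Quotient.mk 1 : k ⧸ m.asIdeal) ≠ 0 := fun h =>
        m.isMaximal.ne_top ((Ideal.eq_top_iff_one _).2 ((Submodule.Quotient.mk_eq_zero _).1 h))
      obtain ⟨f, hf⟩ := hcog (k ⧸ m.asIdeal) _ h1
      set y : N := f (Submodule.Quotient.mk 1) with hy
      have hkill : ∀ r ∈ m.asIdeal, r • y = 0 := by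
        intro r hr
        rw [hy, ← map_smul, ← Submodule.Quotient.mk_smul,
          (Submodule.Quotient.mk_eq_zero _).2 (by simpa using hr), map_zero]
      have hy0 : ((y : T) : Q) ≠ 0 := fun h => hf (Subtype.ext (Subtype.ext h))
      obtain ⟨r, hr, hr0⟩ := hT.2 _ (y : T).2 hy0
      have hrm : r ∉ m.asIdeal := fun h => hr0 (by
        have := hkill r h
        exact congrArg (fun z : N => ((z : T) : Q)) this)
      obtain ⟨x, hx⟩ := hr
      have hxkill : ∀ s ∈ m.asIdeal, s • x = 0 := by
        intro s hs
        apply hι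
        rw [map_smul, hx, map_zero, smul_comm]
        have : s • ((y : T) : Q) = 0 := congrArg (fun z : N => ((z : T) : Q)) (hkill s hs)
        rw [this, smul_zero]
      have hxs : x = DFinsupp.single m (x m) := by
        ext m'
        by_cases h : m = m'
        · subst h; simp
        · rw [DFinsupp.single_eq_of_ne (Ne.symm h)]
          have hnle : ¬ m.asIdeal ≤ m'.asIdeal := fun hle =>
            h (MaximalSpectrum.ext (m.isMaximal.eq_of_le m'.isMaximal.ne_top hle))
          obtain ⟨s, hs, hs'⟩ := Set.not_subset.1 hnle
          have h0 : s • x m' = 0 := by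
            exact DFunLike.congr_fun (hxkill s hs) m'
          obtain ⟨b, hb⟩ := Submodule.Quotient.mk_surjective _ (x m')
          rw [← hb] at h0 ⊢
          rw [← Submodule.Quotient.mk_smul, Submodule.Quotient.mk_eq_zero] at h0
          rw [Submodule.Quotient.mk_eq_zero]
          exact (m'.isMaximal.isPrime.mem_or_mem h0).resolve_left hs'
      obtain ⟨b, hb⟩ := Submodule.Quotient.mk_surjective _ (x m)
      have hbm : b ∉ m.asIdeal := by
        intro h
        have : x m = 0 := by rw [← hb]; exact (Submodule.Quotient.mk_eq_zero _).2 h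
        rw [this, DFinsupp.single_zero] at hxs
        exact hr0 (by rw [← hx, hxs, map_zero])
      obtain ⟨c, hc⟩ := m.isMaximal.exists_inv hbm
      obtain ⟨i, hi, hci⟩ := hc
      obtain ⟨a', rfl⟩ := Submodule.Quotient.mk_surjective _ a
      refine ⟨(a' * c * r) • (y : T), N.smul_mem _ y.2, ?_⟩
      have e1 : (((a' * c * r) • (y : T) : T) : Q) = (a' * c) • (r • ((y : T) : Q)) := by
        rw [Submodule.coe_smul, mul_smul]
      rw [e1, ← hx, ← map_smul, hxs, ← DFinsupp.single_smul, ← hb, ← Submodule.Quotient.mk_smul]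
      congr 2
      rw [Submodule.Quotient.eq]
      have : (a' * c) • b - a' = -(a' * i) := by
        rw [smul_eq_mul]; linear_combination a' * hci
      rw [this]
      exact neg_mem (Ideal.mul_mem_left _ _ hi)
    have hall : ∀ x : S₀, ∃ n ∈ N, (n : Q) = ι x := by
      intro x
      induction x using DFinsupp.induction with
      | h0 => exact ⟨0, N.zero_mem, by simp⟩
      | ha m b f _ _ ih =>
        obtain ⟨n, hn, e⟩ := ih
        obtain ⟨n', hn', e'⟩ := hsingle m b
        exact ⟨n' + n, N.add_mem hn' hn, by rw [Submodule.coe_add, e, e', map_add]⟩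
    obtain ⟨p, hp⟩ := hN.out N.subtype N.subtype_injective LinearMap.id
    rw [eq_top_iff]
    intro t _
    by_contra htN
    set d : T := t - (p t : T) with hd
    have hd0 : (d : Q) ≠ 0 := by
      intro h
      have : t = (p t : T) := sub_eq_zero.1 (Subtype.ext h)
      exact htN (this ▸ (p t).2)
    have hpd : p d = 0 := by
      have := hp (p t)
      simp only [Submodule.subtype_apply, LinearMap.id_apply] at this
      rw [hd, map_sub, this, sub_self]
    obtain ⟨r, ⟨x, hx⟩, hr0⟩ := hT.2 _ d.2 hd0
    obtain ⟨n, hn, e⟩ := hall x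
    have hnd : n = r • d := Subtype.ext (by rw [e, hx, Submodule.coe_smul])
    subst hnd
    have h1 := hp ⟨r • d, hn⟩
    simp only [Submodule.subtype_apply, LinearMap.id_apply] at h1
    rw [map_smul, hpd, smul_zero] at h1
    exact hr0 (congrArg (fun z : N => ((z : T) : Q)) h1).symm

/-- The minimal injective cogenerator of `k`. It is unique up to isomorphism. -/
noncomputable def minimalInjectiveCogenerator (k : Type u₀) [CommRing k] : ModuleCat.{u₀} k :=
  (exists_minimalInjectiveCogenerator k).choose

theorem minimalInjectiveCogenerator_spec (k : Type u₀) [CommRing k] :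
    IsMinimalInjectiveCogenerator k (minimalInjectiveCogenerator k) :=
  (exists_minimalInjectiveCogenerator k).choose_spec

end Cogenerator

/-! ### Extriangulated categories -/

section Extriangulated

attribute [local instance] hasBinaryBiproducts_of_finite_biproducts

/-- A sequence `A ⟶ B ⟶ Z` with prescribed end terms. -/
structure Seq {C : Type u} [Category.{v} C] (A Z : C) where
  mid : C
  i : A ⟶ mid
  p : mid ⟶ Z

/-- Two sequences with the same end terms are equivalent if there is an isomorphism of the middle
terms compatible with the identities of the end terms. -/
instance seqSetoid {C : Type u} [Category.{v} C] (A Z : C) : Setoid (Seq A Z) where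
  r S T := ∃ b : S.mid ≅ T.mid, S.i ≫ b.hom = T.i ∧ b.hom ≫ T.p = S.p
  iseqv :=
    { refl := fun S => ⟨Iso.refl _, by simp, by simp⟩
      symm := fun ⟨b, h₁, h₂⟩ => ⟨b.symm, by simp [← h₁], by simp [← h₂]⟩
      trans := fun ⟨b, h₁, h₂⟩ ⟨b', h₁', h₂'⟩ =>
        ⟨b ≪≫ b', by simp [← h₁', ← h₁], by simp [h₂', h₂]⟩ }

/-- The split sequence `A ⟶ A ⊞ Z ⟶ Z`. -/
noncomputable def Seq.split {C : Type u} [Category.{v} C] [Preadditive C] [HasFiniteBiproducts C]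
    (A Z : C) : Seq A Z :=
  ⟨A ⊞ Z, biprod.inl, biprod.snd⟩

/-- The direct sum of two sequences. -/
noncomputable def Seq.sum {C : Type u} [Category.{v} C] [Preadditive C] [HasFiniteBiproducts C]
    {A Z A' Z' : C} (S : Seq A Z) (S' : Seq A' Z') : Seq (A ⊞ A') (Z ⊞ Z') :=
  ⟨S.mid ⊞ S'.mid, biprod.map S.i S'.i, biprod.map S.p S'.p⟩

section Extensions

variable {k : Type u₀} [CommRing k] {C : Type u} [Category.{v} C]

/-- The module `𝔼(Z, A)` of extensions. -/
abbrev Extension (E : Cᵒᵖ ⥤ C ⥤ ModuleCat.{w} k) (Z A : C) : Type w :=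
  (E.obj (op Z)).obj A

/-- `a_⋆ δ = 𝔼(Z, a)(δ)`, as a linear map in `δ`. -/
def push (E : Cᵒᵖ ⥤ C ⥤ ModuleCat.{w} k) {A A' : C} (a : A ⟶ A') {Z : C} :
    Extension E Z A →ₗ[k] Extension E Z A' :=
  ((E.obj (op Z)).map a).hom

/-- `c^⋆ δ = 𝔼(c, A)(δ)`, as a linear map in `δ`. -/
def pull (E : Cᵒᵖ ⥤ C ⥤ ModuleCat.{w} k) {Z' Z : C} (c : Z' ⟶ Z) {A : C} :
    Extension E Z A →ₗ[k] Extension E Z' A :=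
  ((E.map c.op).app A).hom

/-- `δ ⊕ δ'`: the element of `𝔼(Z ⊞ Z', A ⊞ A')` with components `(δ, 0, 0, δ')`. -/
noncomputable def extSum [Preadditive C] [HasFiniteBiproducts C]
    (E : Cᵒᵖ ⥤ C ⥤ ModuleCat.{w} k) {A Z A' Z' : C}
    (δ : Extension E Z A) (δ' : Extension E Z' A') : Extension E (Z ⊞ Z') (A ⊞ A') :=
  push E (biprod.inl : A ⟶ A ⊞ A') (pull E (biprod.fst : Z ⊞ Z' ⟶ Z) δ) +
    push E (biprod.inr : A' ⟶ A ⊞ A') (pull E (biprod.snd : Z ⊞ Z' ⟶ Z') δ')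

end Extensions

/-- A `k`-linear extriangulated structure `(𝔼, 𝔰)` on a `k`-linear additive category `C`.
For `k = ℤ` this is an extriangulated structure on an additive category. -/
structure Extriangulated (k : Type u₀) [CommRing k] (C : Type u) [Category.{v} C] [Preadditive C]
    [Linear k C] [HasFiniteBiproducts C] where
  /-- (ET1) the bifunctor `𝔼`, which is `k`-linear in both variables -/
  E : Cᵒᵖ ⥤ C ⥤ ModuleCat.{w} k
  push_add : ∀ {A A' Z : C} (a b : A ⟶ A') (δ : Extension E Z A),
    push E (a + b) δ = push E a δ + push E b δ
  push_smul : ∀ {A A' Z : C} (r : k) (a : A ⟶ A') (δ : Extension E Z A),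
    push E (r • a) δ = r • push E a δ
  pull_add : ∀ {Z' Z A : C} (c d : Z' ⟶ Z) (δ : Extension E Z A),
    pull E (c + d) δ = pull E c δ + pull E d δ
  pull_smul : ∀ {Z' Z A : C} (r : k) (c : Z' ⟶ Z) (δ : Extension E Z A),
    pull E (r • c) δ = r • pull E c δ
  /-- the correspondence `𝔰` -/
  s : ∀ {A Z : C}, Extension E Z A → Quotient (seqSetoid A Z)
  /-- (ET2) `𝔰` is a realization -/
  realization : ∀ {A Z A' Z' : C} (δ : Extension E Z A) (δ' : Extension E Z' A')
    (S : Seq A Z) (S' : Seq A' Z'), s δ = ⟦S⟧ → s δ' = ⟦S'⟧ →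
    ∀ (a : A ⟶ A') (c : Z ⟶ Z'), push E a δ = pull E c δ' →
    ∃ b : S.mid ⟶ S'.mid, S.i ≫ b = a ≫ S'.i ∧ S.p ≫ c = b ≫ S'.p
  /-- (ET2) `𝔰` is additive: it sends zero to the split sequence -/
  s_zero : ∀ A Z : C, s (0 : Extension E Z A) = ⟦Seq.split A Z⟧
  /-- (ET2) `𝔰` is additive: it is compatible with direct sums -/
  s_sum : ∀ {A Z A' Z' : C} (δ : Extension E Z A) (δ' : Extension E Z' A')
    (S : Seq A Z) (S' : Seq A' Z'), s δ = ⟦S⟧ → s δ' = ⟦S'⟧ →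
    s (extSum E δ δ') = ⟦S.sum S'⟧
  /-- (ET3) -/
  et3 : ∀ {A Z A' Z' : C} (δ : Extension E Z A) (δ' : Extension E Z' A')
    (S : Seq A Z) (S' : Seq A' Z'), s δ = ⟦S⟧ → s δ' = ⟦S'⟧ →
    ∀ (a : A ⟶ A') (b : S.mid ⟶ S'.mid), S.i ≫ b = a ≫ S'.i →
    ∃ c : Z ⟶ Z', push E a δ = pull E c δ' ∧ S.p ≫ c = b ≫ S'.p
  /-- the dual of (ET3) -/
  et3_op : ∀ {A Z A' Z' : C} (δ : Extension E Z A) (δ' : Extension E Z' A')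
    (S : Seq A Z) (S' : Seq A' Z'), s δ = ⟦S⟧ → s δ' = ⟦S'⟧ →
    ∀ (b : S.mid ⟶ S'.mid) (c : Z ⟶ Z'), S.p ≫ c = b ≫ S'.p →
    ∃ a : A ⟶ A', push E a δ = pull E c δ' ∧ S.i ≫ b = a ≫ S'.i
  /-- (ET4): for `A ⟶ B ⟶ Z` realizing `δ` and `B ⟶ D ⟶ F` realizing `ρ` -/
  et4 : ∀ {A B Z D F : C} (x : A ⟶ B) (y : B ⟶ Z) (u : B ⟶ D) (q : D ⟶ F)
    (δ : Extension E Z A) (ρ : Extension E F B),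
    s δ = ⟦⟨B, x, y⟩⟧ → s ρ = ⟦⟨D, u, q⟩⟧ →
    ∃ (G : C) (ξ : Extension E G A) (z : A ⟶ D) (h : D ⟶ G) (m : Z ⟶ G) (t : G ⟶ F),
      s ξ = ⟦⟨D, z, h⟩⟧ ∧ x ≫ u = z ∧ y ≫ m = u ≫ h ∧ h ≫ t = q ∧
      s (push E y ρ) = ⟦⟨G, m, t⟩⟧ ∧ pull E m ξ = δ ∧ push E x ξ = pull E t ρ
  /-- the dual of (ET4): for `Z ⟶ B ⟶ A` realizing `δ` and `F ⟶ D ⟶ B` realizing `ρ` -/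
  et4_op : ∀ {A B Z D F : C} (y : Z ⟶ B) (x : B ⟶ A) (q : F ⟶ D) (u : D ⟶ B)
    (δ : Extension E A Z) (ρ : Extension E B F),
    s δ = ⟦⟨B, y, x⟩⟧ → s ρ = ⟦⟨D, q, u⟩⟧ →
    ∃ (G : C) (ξ : Extension E A G) (h : G ⟶ D) (z : D ⟶ A) (t : F ⟶ G) (m : G ⟶ Z),
      s ξ = ⟦⟨D, h, z⟩⟧ ∧ u ≫ x = z ∧ m ≫ y = h ≫ u ∧ t ≫ h = q ∧
      s (pull E y ρ) = ⟦⟨G, t, m⟩⟧ ∧ push E m ξ = δ ∧ pull E x ξ = push E t ρ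

end Extriangulated

/-! ### Notions in an additive category -/

section Additive

/-- Every object is a finite direct sum of objects with local endomorphism rings. -/
def IsKrullSchmidt (C : Type u) [Category.{v} C] [Preadditive C] [HasFiniteBiproducts C] : Prop :=
  ∀ X : C, ∃ (n : ℕ) (Y : Fin n → C),
    (∀ i, IsLocalRing (End (Y i))) ∧ Nonempty (X ≅ ⨁ Y)

variable {C : Type u} [Category.{v} C]

/-- `g` factors through `f`. -/
def FactorsThrough {T X Y : C} (g : T ⟶ Y) (f : X ⟶ Y) : Prop :=
  ∃ h : T ⟶ X, h ≫ f = g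

/-- `f` is right `D`-determined. -/
def IsRightDetermined {X Y : C} (f : X ⟶ Y) (D : C) : Prop :=
  ∀ ⦃T : C⦄ (g : T ⟶ Y), (∀ h : D ⟶ T, FactorsThrough (h ≫ g) f) → FactorsThrough g f

def IsRightMinimal {X Y : C} (f : X ⟶ Y) : Prop :=
  ∀ g : X ⟶ X, g ≫ f = f → IsIso g

def RightEquivalent {X X' Y : C} (f : X ⟶ Y) (f' : X' ⟶ Y) : Prop :=
  FactorsThrough f f' ∧ FactorsThrough f' f

/-- `f'` is the right minimal version of `f`. -/
def IsRightMinimalVersion {X X' Y : C} (f : X ⟶ Y) (f' : X' ⟶ Y) : Prop :=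
  IsRightMinimal f' ∧ RightEquivalent f f'

end Additive

/-! ### Notions in an extriangulated category -/

namespace Extriangulated

variable {k : Type u₀} [CommRing k] {C : Type u} [Category.{v} C] [Preadditive C]
  [Linear k C] [HasFiniteBiproducts C] (𝒮 : Extriangulated.{w} k C)

/-- `A ⟶ B ⟶ Z ⇢ δ` is an `𝔰`-triangle. -/
def IsTriangle {A B Z : C} (x : A ⟶ B) (y : B ⟶ Z) (δ : Extension 𝒮.E Z A) : Prop :=
  𝒮.s δ = ⟦⟨B, x, y⟩⟧

def IsInflation {A B : C} (x : A ⟶ B) : Prop :=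
  ∃ (Z : C) (y : B ⟶ Z) (δ : Extension 𝒮.E Z A), 𝒮.IsTriangle x y δ

def IsDeflation {B Z : C} (y : B ⟶ Z) : Prop :=
  ∃ (A : C) (x : A ⟶ B) (δ : Extension 𝒮.E Z A), 𝒮.IsTriangle x y δ

/-- All the modules `𝔼(Z, A)` are finitely generated. -/
def IsExtFinite : Prop :=
  ∀ Z A : C, Module.Finite k (Extension 𝒮.E Z A)

/-- The condition (WIC). -/
structure WIC : Prop where
  inflation : ∀ {A B Z : C} (f : A ⟶ B) (g : B ⟶ Z), 𝒮.IsInflation (f ≫ g) → 𝒮.IsInflation f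
  deflation : ∀ {A B Z : C} (f : A ⟶ B) (g : B ⟶ Z), 𝒮.IsDeflation (f ≫ g) → 𝒮.IsDeflation g

/-- `K` is an intrinsic weak kernel of `f`: there is an `𝔰`-triangle `K ⟶ X' ⟶ Y ⇢` whose second
morphism is the right minimal version of `f`. -/
def IsIntrinsicWeakKernel {X Y : C} (f : X ⟶ Y) (K : C) : Prop :=
  ∃ (X' : C) (f' : X' ⟶ Y) (x : K ⟶ X') (δ : Extension 𝒮.E Y K),
    IsRightMinimalVersion f f' ∧ 𝒮.IsTriangle x f' δ

/-- `f` is an `𝔰`-projective morphism. -/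
def IsProjMor {Z' Z : C} (f : Z' ⟶ Z) : Prop :=
  ∀ (A : C) (δ : Extension 𝒮.E Z A), pull 𝒮.E f δ = 0

/-- Morphisms are identified if they differ by an `𝔰`-projective morphism. -/
def stableRel : HomRel C := fun _ _ f g => 𝒮.IsProjMor (f - g)

theorem pull_zero {Z' Z A : C} (δ : Extension 𝒮.E Z A) : pull 𝒮.E (0 : Z' ⟶ Z) δ = 0 := by
  have := 𝒮.pull_add (0 : Z' ⟶ Z) 0 δ
  simpa using this

theorem pull_sub {Z' Z A : C} (c d : Z' ⟶ Z) (δ : Extension 𝒮.E Z A) :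
    pull 𝒮.E (c - d) δ = pull 𝒮.E c δ - pull 𝒮.E d δ := by
  have := 𝒮.pull_add (c - d) d δ
  rw [sub_add_cancel] at this
  rw [this, add_sub_cancel_right]

theorem pull_id {Z A : C} (δ : Extension 𝒮.E Z A) : pull 𝒮.E (𝟙 Z) δ = δ := by
  simp [pull]

theorem pull_comp {Z'' Z' Z A : C} (d : Z'' ⟶ Z') (c : Z' ⟶ Z) (δ : Extension 𝒮.E Z A) :
    pull 𝒮.E (d ≫ c) δ = pull 𝒮.E d (pull 𝒮.E c δ) := by
  simp [pull]

theorem stableRel_iff {Z' Z : C} (f g : Z' ⟶ Z) :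
    𝒮.stableRel f g ↔ ∀ (A : C) (δ : Extension 𝒮.E Z A), pull 𝒮.E f δ = pull 𝒮.E g δ := by
  simp only [stableRel, IsProjMor, pull_sub, sub_eq_zero]

/-- The `𝔰`-projective morphisms form an ideal. -/
instance : Congruence 𝒮.stableRel where
  equivalence :=
    { refl := fun f => by simp [stableRel_iff]
      symm := fun {f g} h => by
        rw [stableRel_iff] at h ⊢
        exact fun A δ => (h A δ).symm
      trans := fun {f g e} h h' => by
        rw [stableRel_iff] at h h' ⊢
        exact fun A δ => (h A δ).trans (h' A δ) }
  comp_left f g g' h := by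
    rw [stableRel_iff] at h ⊢
    intro A δ
    rw [pull_comp, pull_comp, h]
  comp_right g h := by
    rw [stableRel_iff] at h ⊢
    intro A δ
    rw [pull_comp, pull_comp, h]

/-- The stable category: the quotient of `C` by the ideal of `𝔰`-projective morphisms. -/
abbrev StableCategory : Type u := CategoryTheory.Quotient 𝒮.stableRel

/-- The functor `D𝔼(-, X)` on `C`, where `D = Hom_k(-, J)` and `J` is the minimal injective
cogenerator of `k`. -/
noncomputable def dualExt (X : C) : C ⥤ ModuleCat.{max w u₀} k where
  obj Z := ModuleCat.of k (Extension 𝒮.E Z X →ₗ[k] minimalInjectiveCogenerator k)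
  map c := ModuleCat.ofHom (LinearMap.lcomp k (minimalInjectiveCogenerator k) (pull 𝒮.E c))
  map_id Z := by
    refine ModuleCat.hom_ext (LinearMap.ext fun φ => LinearMap.ext fun δ => ?_)
    exact congrArg (fun ε => (φ : Extension 𝒮.E _ X →ₗ[k] minimalInjectiveCogenerator k) ε)
      (𝒮.pull_id δ)
  map_comp c d := by
    refine ModuleCat.hom_ext (LinearMap.ext fun φ => LinearMap.ext fun δ => ?_)
    exact congrArg (fun ε => (φ : Extension 𝒮.E _ X →ₗ[k] minimalInjectiveCogenerator k) ε)
      (𝒮.pull_comp c d δ)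

/-- The functor `D𝔼(-, X)` on the stable category. -/
noncomputable def stableDualExt (X : C) : 𝒮.StableCategory ⥤ ModuleCat.{max w u₀} k :=
  CategoryTheory.Quotient.lift 𝒮.stableRel (𝒮.dualExt X) (by
    intro Z' Z f g h
    rw [stableRel_iff] at h
    ext φ
    refine LinearMap.ext fun δ => ?_
    let φ' : Extension 𝒮.E Z' X →ₗ[k] minimalInjectiveCogenerator k := φ
    exact congrArg (fun ε => φ' ε) (h X δ))

/-- `X` lies in `C_l`: the covariant functor `D𝔼(-, X)` on the stable category is representable.
(This functor is `k`-linear, so by Yoneda's lemma any natural bijection from a hom functor onto it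
is an isomorphism of functors with values in `k`-modules.) -/
def MemCl (X : C) : Prop :=
  (𝒮.stableDualExt X ⋙ forget (ModuleCat.{max w u₀} k)).IsCorepresentable

end Extriangulated

end Extri

/-! Right determinedness only depends on the right equivalence class, so `α` may be replaced by a
right minimal version `f'`. This is again a deflation by WIC, and lies in a triangle `K ⟶ X' ⟶ Y`
realizing some `δ`. A morphism `g` factors through `f'` exactly when `g^⋆ δ = 0`, so both conditions
become statements about extensions of `K`.

If `D` determines `f'`, right minimality makes `D` detect every nonzero extension of `K`, not only
the pullbacks of `δ` (`IsTriangle.exists_pull_ne_zero`). Detection passes to the indecomposable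
summands `A` of `K`. If `A` has a nonzero extension, the descending chain condition on `𝔼(D, A)`
yields an almost split extension `σ ∈ 𝔼(Z, A)` (`Detects.exists_isRightAlmostSplit`). A functional
`η` with `η σ ≠ 0` then gives a pairing `(g, ε) ↦ η (g^⋆ ε)` that identifies the stable morphisms `Z
⟶ T` with `D𝔼(T, A)` (`IsRightAlmostSplit.isUniversal`); surjectivity is a length count. Summing
over the `A` represents `D𝔼(-, K)`.

Conversely, if `η` on `𝔼(W, K)` is universal, a functional not vanishing on `g^⋆ δ` has the form `η
∘ e^⋆`, so `e ≫ g` does not factor through `f'`, and `W` determines `f'`. -/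

namespace Extri

/-! ### Length estimates for duality into the minimal injective cogenerator -/

section Duality

variable {k : Type u₀} [CommRing k]

/-- Minimality forces each simple module to occur only once in the socle. An injective hull of `kx`
plus the torsion of all other maximal ideals still contains every simple module, hence is all of
`J`; essentiality then places `y` in that sum. -/
theorem IsMinimalInjectiveCogenerator.exists_smul_eq {J : Type u₀} [AddCommGroup J] [Module k J]
    (hJ : IsMinimalInjectiveCogenerator k J) {m : Ideal k} (hm : m.IsMaximal) {x y : J}
    (hx0 : x ≠ 0) (hx : ∀ r ∈ m, r • x = 0) (hy : ∀ r ∈ m, r • y = 0) : ∃ r : k, r • x = y := by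
  have smul_inj : ∀ {e : k} {z : J}, e ∉ m → (∀ r ∈ m, r • z = 0) →
      ∃ c : k, c • (e • z) = z := by
    intro e z he hz
    obtain ⟨c, i, hi, hc⟩ := hm.exists_inv he
    refine ⟨c, ?_⟩
    rw [← mul_smul]
    have h1 : (c * e + i) • z = z := by rw [hc, one_smul]
    rwa [add_smul, hz i hi, add_zero] at h1
  by_cases hy0 : y = 0
  · exact ⟨0, by simp [hy0]⟩
  let L : Submodule k J := ⨆ m' : {m' : Ideal k // m'.IsMaximal ∧ m' ≠ m},
    Submodule.torsionBySet k J (m'.1 : Set k)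
  have hL : ∀ s ∈ L, ∃ e : k, e ∉ m ∧ e • s = 0 := by
    intro s hs
    refine Submodule.iSup_induction _ (motive := fun s => ∃ e : k, e ∉ m ∧ e • s = 0) hs ?_ ?_ ?_
    · rintro ⟨m', hm', hne⟩ z hz
      have hnle : ¬ m' ≤ m := fun hle => hne (hm'.eq_of_le hm.ne_top hle)
      obtain ⟨e, he, he'⟩ := Set.not_subset.1 hnle
      exact ⟨e, he', (Submodule.mem_torsionBySet_iff _ _).1 hz ⟨e, he⟩⟩
    · exact ⟨1, (Ideal.ne_top_iff_one m).1 hm.ne_top, smul_zero _⟩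
    · rintro a b ⟨e, he, hea⟩ ⟨e', he', heb⟩
      refine ⟨e * e', fun h => (hm.isPrime.mem_or_mem h).elim he he', ?_⟩
      rw [smul_add, mul_smul, mul_smul, heb, smul_comm, hea, smul_zero, smul_zero, add_zero]
  obtain ⟨T, hT, hTinj⟩ := exists_injective_essential hJ.injective (L ⊔ Submodule.span k {x})
  have hsimple : ∀ m' : Ideal k, m'.IsMaximal → ∃ z : T, z ≠ 0 ∧ ∀ r ∈ m', r • z = 0 := by
    intro m' hm'
    by_cases h : m' = m
    · subst h
      refine ⟨⟨x, hT.1 (Submodule.mem_sup_right (Submodule.mem_span_singleton_self x))⟩,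
        fun h => hx0 (congrArg Subtype.val h), fun r hr => Subtype.ext (hx r hr)⟩
    · have h1 : (Submodule.Quotient.mk 1 : k ⧸ m') ≠ 0 := fun h =>
        hm'.ne_top ((Ideal.eq_top_iff_one _).2 ((Submodule.Quotient.mk_eq_zero _).1 h))
      obtain ⟨f, hf⟩ := hJ.cogenerator (k ⧸ m') _ h1
      have hkill : ∀ r ∈ m', r • f (Submodule.Quotient.mk 1) = 0 := by
        intro r hr
        rw [← map_smul, ← Submodule.Quotient.mk_smul,
          (Submodule.Quotient.mk_eq_zero _).2 (by simpa using hr), map_zero]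
      have hmem : f (Submodule.Quotient.mk 1) ∈ L :=
        Submodule.mem_iSup_of_mem (p := fun m' : {m' : Ideal k // m'.IsMaximal ∧ m' ≠ m} =>
          Submodule.torsionBySet k J (m'.1 : Set k)) ⟨m', hm', h⟩
          ((Submodule.mem_torsionBySet_iff _ _).2 fun r => hkill r.1 r.2)
      exact ⟨⟨_, hT.1 (Submodule.mem_sup_left hmem)⟩, fun h => hf (congrArg Subtype.val h),
        fun r hr => Subtype.ext (hkill r hr)⟩
  have hTtop : T = ⊤ := by
    refine hJ.minimal T hTinj fun M _ _ x hx => ?_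
    have hne : LinearMap.ker (LinearMap.toSpanSingleton k M x) ≠ ⊤ := by
      intro h
      have : (1 : k) ∈ LinearMap.ker (LinearMap.toSpanSingleton k M x) := h ▸ Submodule.mem_top
      exact hx (by simpa using this)
    obtain ⟨m', hm', hle⟩ := Ideal.exists_le_maximal _ hne
    obtain ⟨z, hz0, hz⟩ := hsimple m' hm'
    let a : (k ⧸ LinearMap.ker (LinearMap.toSpanSingleton k M x)) →ₗ[k] T :=
      Submodule.liftQ _ (LinearMap.toSpanSingleton k T z) fun r hr => by
        simpa using hz r (hle hr)
    let i : (k ⧸ LinearMap.ker (LinearMap.toSpanSingleton k M x)) →ₗ[k] M :=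
      Submodule.liftQ _ (LinearMap.toSpanSingleton k M x) le_rfl
    have hi : Function.Injective i :=
      LinearMap.ker_eq_bot.1 (Submodule.ker_liftQ_eq_bot _ _ _ le_rfl)
    obtain ⟨f, hf⟩ := hTinj.out i hi a
    refine ⟨f, ?_⟩
    have h1 := hf (Submodule.Quotient.mk 1)
    have h2 : i (Submodule.Quotient.mk 1) = x := by
      change LinearMap.toSpanSingleton k M x 1 = x
      simp
    have h3 : a (Submodule.Quotient.mk 1) = z := by
      change LinearMap.toSpanSingleton k T z 1 = z
      simp
    rw [h2, h3] at h1
    rwa [h1]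
  obtain ⟨r, hr, hr0⟩ := hT.2 y (hTtop ▸ Submodule.mem_top) hy0
  have hrm : r ∉ m := fun h => hr0 (hy r h)
  obtain ⟨c, hc⟩ := smul_inj hrm hy
  have hyS : y ∈ L ⊔ Submodule.span k {x} := hc ▸ Submodule.smul_mem _ c hr
  obtain ⟨s, hs, z, hz, hsz⟩ := Submodule.mem_sup.1 hyS
  obtain ⟨d, rfl⟩ := Submodule.mem_span_singleton.1 hz
  -- The component `s` of `y` is killed by `m` and by some `e ∉ m`, hence vanishes.
  obtain ⟨e, he, hes⟩ := hL s hs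
  have hsm : ∀ r ∈ m, r • s = 0 := by
    intro r hr
    have : s = y - d • x := by rw [← hsz, add_sub_cancel_right]
    rw [this, smul_sub, hy r hr, smul_comm, hx r hr, smul_zero, sub_zero]
  obtain ⟨c', hc'⟩ := smul_inj he hsm
  rw [hes, smul_zero] at hc'
  exact ⟨d, by rw [← hsz, ← hc', zero_add]⟩

variable {J : Type u₀} [AddCommGroup J] [Module k J]

theorem IsMinimalInjectiveCogenerator.length_dual_simple_le
    (hJ : IsMinimalInjectiveCogenerator k J) (S : Type w) [AddCommGroup S] [Module k S]
    [IsSimpleModule k S] : Module.length k (S →ₗ[k] J) ≤ 1 := by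
  cases subsingleton_or_nontrivial (S →ₗ[k] J) with
  | inl h => rw [Module.length_eq_zero]; exact zero_le_one
  | inr h =>
    have : IsSimpleModule k (S →ₗ[k] J) := by
      rw [isSimpleModule_iff_toSpanSingleton_surjective]
      refine ⟨h, fun f hf g => ?_⟩
      have := IsSimpleModule.nontrivial k S
      obtain ⟨s, hs⟩ := exists_ne (0 : S)
      have hsurj := IsSimpleModule.toSpanSingleton_surjective k hs
      have hmax := IsSimpleModule.ker_toSpanSingleton_isMaximal k hs
      have hker : ∀ (f : S →ₗ[k] J), ∀ r ∈ LinearMap.ker (LinearMap.toSpanSingleton k S s),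
          r • f s = 0 := by
        intro f r hr
        have h0 : r • s = 0 := by simpa using hr
        rw [← map_smul, h0, map_zero]
      have hfs : f s ≠ 0 := by
        intro h0
        refine hf (LinearMap.ext fun t => ?_)
        obtain ⟨r, rfl⟩ := hsurj t
        simp [h0]
      obtain ⟨r, hr⟩ := hJ.exists_smul_eq hmax hfs (hker f) (hker g)
      refine ⟨r, LinearMap.ext fun t => ?_⟩
      obtain ⟨c, rfl⟩ := hsurj t
      simp [← hr]
    rw [Module.length_eq_one]

/-- Left exactness of `Hom(-, J)`; an inequality suffices later, so `J` need not be injective here.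
-/
theorem length_dual_le_add {M : Type w} [AddCommGroup M] [Module k M] (p : Submodule k M) :
    Module.length k (M →ₗ[k] J) ≤
      Module.length k (p →ₗ[k] J) + Module.length k ((M ⧸ p) →ₗ[k] J) := by
  let res : (M →ₗ[k] J) →ₗ[k] (p →ₗ[k] J) := LinearMap.lcomp k J p.subtype
  let inf : ((M ⧸ p) →ₗ[k] J) →ₗ[k] LinearMap.ker res :=
    LinearMap.codRestrict _ (LinearMap.lcomp k J p.mkQ) fun φ => by
      rw [LinearMap.mem_ker]
      refine LinearMap.ext fun x => ?_
      change φ (p.mkQ x) = 0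
      rw [Submodule.mkQ_apply, (Submodule.Quotient.mk_eq_zero p).2 x.2, map_zero]
  have hinf : Function.Surjective inf := by
    rintro ⟨φ, hφ⟩
    refine ⟨p.liftQ φ fun x hx => ?_, Subtype.ext (LinearMap.ext fun x => rfl)⟩
    exact DFunLike.congr_fun (LinearMap.mem_ker.1 hφ) (⟨x, hx⟩ : p)
  rw [Module.length_eq_add_of_exact (LinearMap.ker res).subtype res.rangeRestrict
    (Submodule.subtype_injective _) res.surjective_rangeRestrict (by
      rw [LinearMap.exact_iff, LinearMap.ker_rangeRestrict, Submodule.range_subtype]), add_comm]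
  exact add_le_add (Module.length_le_of_injective _ (Submodule.subtype_injective _))
    (Module.length_le_of_surjective inf hinf)

theorem IsMinimalInjectiveCogenerator.length_dual_le
    (hJ : IsMinimalInjectiveCogenerator k J) {M : Type w} [AddCommGroup M] [Module k M] :
    Module.length k (M →ₗ[k] J) ≤ Module.length k M := by
  by_cases htop : Module.length k M = ⊤
  · rw [htop]; exact le_top
  obtain ⟨n, hn⟩ := ENat.ne_top_iff_exists.1 htop
  clear htop
  have hle : Module.length k M ≤ n := hn.ge
  clear hn
  induction n generalizing M with
  | zero =>
    have : Subsingleton M := Module.length_eq_zero_iff.1 (nonpos_iff_eq_zero.1 (by simpa using hle))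
    rw [Module.length_eq_zero]
    exact zero_le
  | succ n ih =>
    cases subsingleton_or_nontrivial M with
    | inl h => rw [Module.length_eq_zero]; exact zero_le
    | inr h =>
      have hfl : IsFiniteLength k M := Module.length_ne_top_iff.1
        (ne_top_of_le_ne_top (ENat.natCast_ne_top _) hle)
      have := (isFiniteLength_iff_isNoetherian_isArtinian.1 hfl).1
      obtain ⟨p, hp⟩ := IsCoatomic.exists_coatom (Submodule k M)
      have : IsSimpleModule k (M ⧸ p) := isSimpleModule_iff_isCoatom.2 hp
      have hlen : Module.length k M = Module.length k p + 1 := by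
        rw [← Module.length_eq_one k (M ⧸ p)]
        exact Module.length_eq_add_of_exact p.subtype p.mkQ p.subtype_injective p.mkQ_surjective
          (LinearMap.exact_subtype_mkQ p)
      rw [hlen, Nat.cast_succ] at hle
      have hpn : Module.length k p ≤ n :=
        (ENat.add_le_add_iff_right (by simp)).1 hle
      rw [hlen]
      exact (length_dual_le_add p).trans
        (add_le_add (ih hpn) (hJ.length_dual_simple_le (M ⧸ p)))

/-- A separating `N` embeds `M` into the dual of `N`, so `M` is no longer than `N`. A proper `N`
would be strictly shorter than the dual of `M`, which is no longer than `M`. -/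
theorem IsMinimalInjectiveCogenerator.eq_top_of_annihilator_eq_bot
    (hJ : IsMinimalInjectiveCogenerator k J) {M : Type w} [AddCommGroup M] [Module k M]
    (hM : IsFiniteLength k M) (N : Submodule k (M →ₗ[k] J))
    (hN : ∀ x : M, (∀ φ ∈ N, φ x = 0) → x = 0) : N = ⊤ := by
  have hdual : IsFiniteLength k (M →ₗ[k] J) := Module.length_ne_top_iff.1
    (ne_top_of_le_ne_top (Module.length_ne_top_iff.2 hM) hJ.length_dual_le)
  obtain ⟨_, _⟩ := isFiniteLength_iff_isNoetherian_isArtinian.1 hdual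
  by_contra hne
  have h1 : Module.length k M ≤ Module.length k (N →ₗ[k] J) := by
    refine Module.length_le_of_injective (LinearMap.flip N.subtype) ?_
    rw [← LinearMap.ker_eq_bot, LinearMap.ker_eq_bot']
    exact fun x hx => hN x fun φ hφ => DFunLike.congr_fun hx (⟨φ, hφ⟩ : N)
  exact absurd ((h1.trans hJ.length_dual_le).trans_lt (Submodule.length_lt hne))
    (not_lt.2 hJ.length_dual_le)

/-- The cogenerator property concerns modules in the universe of `k`; a finite module in any
universe is isomorphic to a quotient of some `k^n`, which lives there. -/
theorem IsMinimalInjectiveCogenerator.exists_apply_ne_zero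
    (hJ : IsMinimalInjectiveCogenerator k J) {M : Type w} [AddCommGroup M] [Module k M]
    [Module.Finite k M] {x : M} (hx : x ≠ 0) : ∃ f : M →ₗ[k] J, f x ≠ 0 := by
  obtain ⟨n, q, hq⟩ := Module.Finite.exists_fin' k M
  let e := q.quotKerEquivOfSurjective hq
  obtain ⟨f, hf⟩ := hJ.cogenerator _ (e.symm x) (by simpa using hx)
  exact ⟨f ∘ₗ e.symm.toLinearMap, hf⟩

end Duality
end Extri

namespace Extri

/-! ### Right minimal versions in Krull–Schmidt categories -/

section RightMinimal

variable {C : Type u} [Category.{v} C]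

theorem FactorsThrough.trans {T S X Y : C} {e : T ⟶ Y} {g : S ⟶ Y} {f : X ⟶ Y}
    (h : FactorsThrough e g) (h' : FactorsThrough g f) : FactorsThrough e f := by
  obtain ⟨a, rfl⟩ := h
  obtain ⟨b, rfl⟩ := h'
  exact ⟨a ≫ b, by simp⟩

theorem RightEquivalent.isRightDetermined_iff {X X' Y : C} {f : X ⟶ Y} {f' : X' ⟶ Y}
    (h : RightEquivalent f f') (D : C) : IsRightDetermined f D ↔ IsRightDetermined f' D :=
  ⟨fun H _ g hg => (H g fun a => (hg a).trans h.2).trans h.1,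
    fun H _ g hg => (H g fun a => (hg a).trans h.1).trans h.2⟩

variable [Preadditive C]

/-- The ring identity `(1 + ab)⁻¹ = 1 - a(1 + ba)⁻¹b`, for morphisms between different objects. -/
theorem isIso_id_add_comp_of_isIso {X Y : C} (a : X ⟶ Y) (b : Y ⟶ X) [IsIso (𝟙 Y + b ≫ a)] :
    IsIso (𝟙 X + a ≫ b) := by
  have h1 : inv (𝟙 Y + b ≫ a) + inv (𝟙 Y + b ≫ a) ≫ b ≫ a = 𝟙 Y := by
    have := IsIso.inv_hom_id (𝟙 Y + b ≫ a)
    rwa [Preadditive.comp_add, Category.comp_id] at this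
  have h2 : inv (𝟙 Y + b ≫ a) + b ≫ a ≫ inv (𝟙 Y + b ≫ a) = 𝟙 Y := by
    have := IsIso.hom_inv_id (𝟙 Y + b ≫ a)
    rwa [Preadditive.add_comp, Category.id_comp, Category.assoc] at this
  refine ⟨𝟙 X - a ≫ inv (𝟙 Y + b ≫ a) ≫ b, ?_, ?_⟩
  · have h3 : a ≫ (inv (𝟙 Y + b ≫ a) + b ≫ a ≫ inv (𝟙 Y + b ≫ a)) ≫ b = a ≫ b := by
      rw [h2, Category.id_comp]
    simp only [Preadditive.add_comp, Preadditive.comp_add, Category.assoc] at h3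
    simp only [Preadditive.add_comp, Preadditive.comp_sub, Category.assoc, Category.id_comp,
      Category.comp_id]
    rw [← h3]; abel
  · have h3 : a ≫ (inv (𝟙 Y + b ≫ a) + inv (𝟙 Y + b ≫ a) ≫ b ≫ a) ≫ b = a ≫ b := by
      rw [h1, Category.id_comp]
    simp only [Preadditive.add_comp, Preadditive.comp_add, Category.assoc] at h3
    simp only [Preadditive.sub_comp, Preadditive.comp_add, Category.assoc, Category.id_comp,
      Category.comp_id]
    linear_combination (norm := abel) -h3

theorem isIso_or_isIso_of_add_eq_id {X : C} [IsLocalRing (End X)] (a b : X ⟶ X)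
    (h : a + b = 𝟙 X) : IsIso a ∨ IsIso b := by
  rw [← isUnit_iff_isIso (f := a), ← isUnit_iff_isIso (f := b)]
  exact IsLocalRing.isUnit_or_isUnit_of_add_one (R := End X) h

/-- A split monomorphism between objects with local endomorphism rings is an isomorphism. -/
theorem isIso_of_comp_eq_id {X Y : C} [IsLocalRing (End X)] [IsLocalRing (End Y)]
    (a : X ⟶ Y) (b : Y ⟶ X) (h : a ≫ b = 𝟙 X) : IsIso a := by
  have hba : IsIso (b ≫ a) := by
    refine (isIso_or_isIso_of_add_eq_id (b ≫ a) (𝟙 Y - b ≫ a) (by abel)).resolve_right fun hi => ?_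
    have h0 : (b ≫ a) ≫ (𝟙 Y - b ≫ a) = 0 := by
      simp [Preadditive.comp_sub, reassoc_of% h]
    have h1 : b ≫ a = 0 := by
      rw [← cancel_mono (𝟙 Y - b ≫ a), h0, zero_comp]
    have h2 : 𝟙 X = 0 := by
      calc 𝟙 X = a ≫ (b ≫ a) ≫ b := by simp [h]
        _ = 0 := by rw [h1]; simp
    exact one_ne_zero (α := End X) h2
  have : IsIso b := by
    refine ⟨a, ?_, h⟩
    rw [← cancel_mono (b ≫ a), Category.assoc, reassoc_of% h, Category.id_comp]
  rw [(IsIso.eq_inv_of_inv_hom_id (f := b) h : a = inv b)]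
  infer_instance

theorem isIso_of_isIso_comp {X Y : C} [IsLocalRing (End X)] [IsLocalRing (End Y)]
    (a : X ⟶ Y) (b : Y ⟶ X) [IsIso (a ≫ b)] : IsIso a :=
  isIso_of_comp_eq_id a (b ≫ inv (a ≫ b)) (by rw [← Category.assoc, IsIso.hom_inv_id])

variable [HasFiniteBiproducts C]

theorem sum_comp_of_iso_biproduct {n : ℕ} {X : C} {Y : Fin n → C} (φ : X ≅ ⨁ Y) :
    ∑ i, (φ.hom ≫ biproduct.π Y i) ≫ biproduct.ι Y i ≫ φ.inv = 𝟙 X := by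
  calc _ = φ.hom ≫ (∑ i, biproduct.π Y i ≫ biproduct.ι Y i) ≫ φ.inv := by
        simp only [Preadditive.comp_sum, Preadditive.sum_comp, Category.assoc]
    _ = 𝟙 X := by rw [biproduct.total, Category.id_comp, Iso.hom_inv_id]

/-- An endomorphism of a finite direct sum of objects with local endomorphism rings none of whose
components is an isomorphism is quasi-regular. -/
theorem isIso_id_add_of_components {n : ℕ} {Y : Fin n → C} (hY : ∀ i, IsLocalRing (End (Y i)))
    (h : (⨁ Y) ⟶ (⨁ Y)) (hh : ∀ i j, ¬ IsIso (biproduct.ι Y i ≫ h ≫ biproduct.π Y j)) :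
    IsIso (𝟙 _ + h) := by
  let e : ∀ i, End (⨁ Y) := fun i => biproduct.π Y i ≫ biproduct.ι Y i
  have he : ∑ i, e i = 1 := biproduct.total
  let h' : End (⨁ Y) := h
  have hJ : h' ∈ Ideal.jacobson (⊥ : Ideal (End (⨁ Y))) := by
    have hsum : h' = ∑ i, ∑ j, e j * h' * e i := by
      calc h' = (∑ j, e j) * h' * ∑ i, e i := by rw [he, one_mul, mul_one]
        _ = _ := by simp_rw [Finset.mul_sum, Finset.sum_mul]
    rw [hsum]
    -- Each matrix entry lies in the Jacobson radical: a non-isomorphism `b` between local objects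
    -- makes `𝟙 + b ≫ c` invertible for every `c`, and the `1 + ab` identity carries this to `End (⨁
    -- Y)`.
    refine Ideal.sum_mem _ fun i _ => Ideal.sum_mem _ fun j _ => ?_
    rw [Ideal.mem_jacobson_iff]
    intro y
    let b : Y i ⟶ Y j := biproduct.ι Y i ≫ h ≫ biproduct.π Y j
    let c : Y j ⟶ Y i := biproduct.ι Y j ≫ (show (⨁ Y) ⟶ (⨁ Y) from y) ≫ biproduct.π Y i
    have := hY i
    have := hY j
    have hbc : IsIso (𝟙 (Y i) + b ≫ c) := by
      refine (isIso_or_isIso_of_add_eq_id (𝟙 (Y i) + b ≫ c) (-(b ≫ c)) (by abel)).resolve_right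
        fun hi => hh i j ?_
      have : IsIso (b ≫ (-c)) := by rwa [Preadditive.comp_neg]
      exact isIso_of_isIso_comp b (-c)
    have hiso : IsIso (𝟙 (⨁ Y) + biproduct.π Y i ≫ biproduct.ι Y i ≫ h ≫ biproduct.π Y j ≫
        biproduct.ι Y j ≫ (show (⨁ Y) ⟶ (⨁ Y) from y)) := by
      have : IsIso (𝟙 (Y i) + (biproduct.ι Y i ≫ h ≫ biproduct.π Y j ≫
        biproduct.ι Y j ≫ (show (⨁ Y) ⟶ (⨁ Y) from y)) ≫ biproduct.π Y i) := by
        simpa [b, c] using hbc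
      exact isIso_id_add_comp_of_isIso _ _
    refine ⟨inv (𝟙 (⨁ Y) + biproduct.π Y i ≫ biproduct.ι Y i ≫ h ≫ biproduct.π Y j ≫
        biproduct.ι Y j ≫ (show (⨁ Y) ⟶ (⨁ Y) from y)), ?_⟩
    rw [Ideal.mem_bot, sub_eq_zero]
    have hz := IsIso.hom_inv_id (𝟙 (⨁ Y) + biproduct.π Y i ≫ biproduct.ι Y i ≫ h ≫
      biproduct.π Y j ≫ biproduct.ι Y j ≫ (show (⨁ Y) ⟶ (⨁ Y) from y))
    rw [Preadditive.add_comp, Category.id_comp, add_comm] at hz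
    simp only [Category.assoc] at hz
    simpa [e, h', End.mul_def] using hz
  obtain ⟨z, hz⟩ := Ideal.mem_jacobson_iff.1 hJ 1
  -- The left inverse `z` of `1 + h'` has itself a left inverse `t`, so it is two-sided.
  obtain ⟨t, ht⟩ := Ideal.mem_jacobson_iff.1 hJ (-z)
  rw [Ideal.mem_bot, sub_eq_zero, mul_one] at hz
  rw [Ideal.mem_bot, sub_eq_zero] at ht
  have h1 : z * (1 + h') = 1 := by rw [mul_add, mul_one, add_comm]; exact hz
  have h2 : t * z = 1 := by
    rw [← ht]
    conv_lhs => rw [show z = 1 - z * h' from eq_sub_of_add_eq' hz]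
    rw [mul_sub, mul_one, mul_neg, neg_mul, mul_assoc]
    abel
  have h3 : t = 1 + h' := left_inv_eq_right_inv h2 h1
  exact (isUnit_iff_isIso (C := C) (1 + h')).1 ⟨⟨1 + h', z, h3 ▸ h2, h1⟩, rfl⟩

/-- Gaussian elimination: subtracting a multiple of `h` from the identity gives `p` with no
component into `Y j`. Since `h ≫ f = 0`, still `p ≫ f = f`, so the summand `Y j` is superfluous. -/
theorem exists_rightEquivalent_of_component_isIso {n : ℕ} {Y : Fin (n + 1) → C} {Z : C}
    (f : (⨁ Y) ⟶ Z) (h : (⨁ Y) ⟶ (⨁ Y)) (hf : h ≫ f = 0) (i j : Fin (n + 1))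
    (hij : IsIso (biproduct.ι Y i ≫ h ≫ biproduct.π Y j)) :
    ∃ f' : (⨁ fun l => Y (j.succAbove l)) ⟶ Z, RightEquivalent f f' := by
  let inc : (⨁ fun l => Y (j.succAbove l)) ⟶ ⨁ Y :=
    biproduct.desc fun l => biproduct.ι Y (j.succAbove l)
  let prj : (⨁ Y) ⟶ ⨁ fun l => Y (j.succAbove l) :=
    biproduct.lift fun l => biproduct.π Y (j.succAbove l)
  have htotal : prj ≫ inc = 𝟙 _ - biproduct.π Y j ≫ biproduct.ι Y j := by
    rw [← biproduct.total (f := Y), Fin.sum_univ_succAbove _ j, biproduct.lift_desc]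
    abel
  let c := biproduct.ι Y i ≫ h ≫ biproduct.π Y j
  let p : (⨁ Y) ⟶ ⨁ Y := 𝟙 _ - biproduct.π Y j ≫ inv c ≫ biproduct.ι Y i ≫ h
  have hpj : p ≫ biproduct.π Y j = 0 := by
    have : inv c ≫ biproduct.ι Y i ≫ h ≫ biproduct.π Y j = 𝟙 _ := IsIso.inv_hom_id c
    simp [p, Preadditive.sub_comp, this]
  have hpf : p ≫ f = f := by
    simp [p, Preadditive.sub_comp, hf]
  refine ⟨inc ≫ f, ⟨p ≫ prj, ?_⟩, ⟨inc, rfl⟩⟩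
  have : (p ≫ prj) ≫ inc = p := by
    rw [Category.assoc, htotal, Preadditive.comp_sub, Category.comp_id, reassoc_of% hpj,
      zero_comp, sub_zero]
  rw [← Category.assoc, this, hpf]

/-- Take a right equivalent `f'` whose source has the fewest local summands. If `g ≫ f' = f'`, then
`g - 𝟙` has no invertible component, as that would let a summand be dropped; hence `g` is
invertible. -/
theorem IsKrullSchmidt.exists_isRightMinimalVersion (hC : IsKrullSchmidt C) {X Z : C}
    (f : X ⟶ Z) : ∃ (X' : C) (f' : X' ⟶ Z), IsRightMinimalVersion f f' := by
  classical
  have hex : ∃ n : ℕ, ∃ (Y : Fin n → C) (f' : (⨁ Y) ⟶ Z),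
      (∀ i, IsLocalRing (End (Y i))) ∧ RightEquivalent f f' := by
    obtain ⟨n, Y, hY, ⟨e⟩⟩ := hC X
    exact ⟨n, Y, e.inv ≫ f, hY, ⟨e.hom, by simp⟩, ⟨e.inv, rfl⟩⟩
  obtain ⟨Y, f', hY, hf'⟩ := Nat.find_spec hex
  refine ⟨_, f', fun g hg => ?_, hf'⟩
  have hcomp : ∀ i j, ¬ IsIso (biproduct.ι Y i ≫ (g - 𝟙 _) ≫ biproduct.π Y j) := by
    have hmin := fun m => Nat.find_min (H := hex) (m := m)
    generalize Nat.find hex = n at *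
    intro i j hij
    cases n with
    | zero => exact i.elim0
    | succ n =>
      obtain ⟨f'', hf''⟩ := exists_rightEquivalent_of_component_isIso f' (g - 𝟙 _)
        (by rw [Preadditive.sub_comp, hg, Category.id_comp, sub_self]) i j hij
      exact hmin n n.lt_succ_self ⟨_, f'', fun l => hY _, hf'.1.trans hf''.1, hf''.2.trans hf'.2⟩
  have := isIso_id_add_of_components hY _ hcomp
  rwa [add_sub_cancel] at this

end RightMinimal
end Extri

/-! ### Exact sequences of a triangle, and detection of extensions -/

namespace Extri
namespace Extriangulated

attribute [local instance] hasBinaryBiproducts_of_finite_biproducts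

variable {k : Type u₀} [CommRing k] {C : Type u} [Category.{v} C] [Preadditive C]
  [Linear k C] [HasFiniteBiproducts C] (𝒮 : Extriangulated.{w} k C)

section Extension

variable {𝒮}

theorem push_zero {Z A A' : C} (δ : Extension 𝒮.E Z A) : push 𝒮.E (0 : A ⟶ A') δ = 0 := by
  have := 𝒮.push_add (0 : A ⟶ A') 0 δ
  simpa using this

theorem push_sub {Z A A' : C} (a b : A ⟶ A') (δ : Extension 𝒮.E Z A) :
    push 𝒮.E (a - b) δ = push 𝒮.E a δ - push 𝒮.E b δ := by
  have := 𝒮.push_add (a - b) b δ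
  rw [sub_add_cancel] at this
  rw [this, add_sub_cancel_right]

theorem push_id {Z A : C} (δ : Extension 𝒮.E Z A) : push 𝒮.E (𝟙 A) δ = δ := by
  simp [push]

theorem push_comp {Z A A' A'' : C} (a : A ⟶ A') (b : A' ⟶ A'') (δ : Extension 𝒮.E Z A) :
    push 𝒮.E (a ≫ b) δ = push 𝒮.E b (push 𝒮.E a δ) := by
  simp [push]

theorem pull_push {Z Z' A A' : C} (c : Z' ⟶ Z) (a : A ⟶ A') (δ : Extension 𝒮.E Z A) :
    pull 𝒮.E c (push 𝒮.E a δ) = push 𝒮.E a (pull 𝒮.E c δ) := by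
  have := (𝒮.E.map c.op).naturality a
  exact congrArg (fun φ => φ.hom δ) this

theorem push_sum {ι : Type*} (s : Finset ι) {Z A A' : C} (a : ι → (A ⟶ A'))
    (δ : Extension 𝒮.E Z A) : push 𝒮.E (∑ i ∈ s, a i) δ = ∑ i ∈ s, push 𝒮.E (a i) δ := by
  classical
  induction s using Finset.induction_on with
  | empty => simp [push_zero]
  | insert i s hi ih => rw [Finset.sum_insert hi, Finset.sum_insert hi, 𝒮.push_add, ih]

theorem pull_sum {ι : Type*} (s : Finset ι) {Z Z' A : C} (c : ι → (Z' ⟶ Z))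
    (δ : Extension 𝒮.E Z A) : pull 𝒮.E (∑ i ∈ s, c i) δ = ∑ i ∈ s, pull 𝒮.E (c i) δ := by
  classical
  induction s using Finset.induction_on with
  | empty => simp [pull_zero]
  | insert i s hi ih => rw [Finset.sum_insert hi, Finset.sum_insert hi, 𝒮.pull_add, ih]

theorem exists_isTriangle {Z A : C} (δ : Extension 𝒮.E Z A) :
    ∃ (B : C) (x : A ⟶ B) (y : B ⟶ Z), 𝒮.IsTriangle x y δ := by
  obtain ⟨S, hS⟩ := Quotient.exists_rep (𝒮.s δ)
  exact ⟨S.mid, S.i, S.p, hS.symm⟩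

theorem isTriangle_split (A Z : C) : 𝒮.IsTriangle (biprod.inl : A ⟶ A ⊞ Z) biprod.snd
    (0 : Extension 𝒮.E Z A) :=
  𝒮.s_zero A Z

end Extension

section Exactness

variable {𝒮} {A B Z : C} {x : A ⟶ B} {y : B ⟶ Z} {δ : Extension 𝒮.E Z A}

/-- Comparison with the split triangle ending in the empty biproduct, a zero object. -/
theorem IsTriangle.comp_eq_zero (h : 𝒮.IsTriangle x y δ) : x ≫ y = 0 := by
  obtain ⟨c, -, hc⟩ := 𝒮.et3 _ _ _ _ (isTriangle_split A (⨁ (fun i : Fin 0 => i.elim0 : Fin 0 → C))) h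
    (𝟙 A) (biprod.fst ≫ x) (by simp)
  have hc0 : c = 0 := biproduct.hom_ext' _ _ fun i => i.elim0
  have := (biprod.inl : A ⟶ _) ≫= hc
  simpa [hc0] using this.symm

theorem IsTriangle.pull_eq_zero (h : 𝒮.IsTriangle x y δ) : pull 𝒮.E y δ = 0 := by
  obtain ⟨a, ha, -⟩ := 𝒮.et3_op _ _ _ _ (isTriangle_split A B) h (biprod.desc x (𝟙 B)) y
    (by ext <;> simp [h.comp_eq_zero])
  rw [← ha, map_zero]

theorem IsTriangle.push_eq_zero (h : 𝒮.IsTriangle x y δ) : push 𝒮.E x δ = 0 := by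
  obtain ⟨c, hc, -⟩ := 𝒮.et3 _ _ _ _ h (isTriangle_split B Z) x (biprod.lift (𝟙 B) y)
    (by ext <;> simp [h.comp_eq_zero])
  rw [hc, map_zero]

/-- Exactness of `C(T, B) ⟶ C(T, Z) ⟶ 𝔼(T, A)`: a lift is read off from a map out of the split
triangle. -/
theorem IsTriangle.factorsThrough_iff (h : 𝒮.IsTriangle x y δ) {T : C} (g : T ⟶ Z) :
    FactorsThrough g y ↔ pull 𝒮.E g δ = 0 := by
  constructor
  · rintro ⟨e, rfl⟩
    rw [pull_comp, h.pull_eq_zero, map_zero]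
  · intro hg
    obtain ⟨b, -, hb⟩ := 𝒮.realization _ _ _ _ (isTriangle_split A T) h (𝟙 A) g
      (by rw [hg, map_zero])
    have hb : (biprod.snd : A ⊞ T ⟶ T) ≫ g = b ≫ y := hb
    exact ⟨biprod.inr ≫ b, by rw [Category.assoc, ← hb]; simp⟩

theorem IsTriangle.exists_pull_eq (h : 𝒮.IsTriangle x y δ) {T : C} {ε : Extension 𝒮.E T A}
    (hε : push 𝒮.E x ε = 0) : ∃ g : T ⟶ Z, pull 𝒮.E g δ = ε := by
  obtain ⟨M, i, p, hM⟩ := exists_isTriangle ε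
  obtain ⟨b, hb, -⟩ := 𝒮.realization _ _ _ _ hM (isTriangle_split B T) x (𝟙 T)
    (by rw [hε, map_zero])
  have hb : i ≫ b = x ≫ biprod.inl := hb
  obtain ⟨c, hc, -⟩ := 𝒮.et3 _ _ _ _ hM h (𝟙 A) (b ≫ biprod.fst) (by simp [reassoc_of% hb])
  exact ⟨c, by rw [← hc, push_id]⟩

/-- If the deflation of `ε` factors through that of `δ`, then `δ` is a pushout of `ε`. -/
theorem IsTriangle.exists_push_eq (h : 𝒮.IsTriangle x y δ) {A' N : C} {i : A' ⟶ N} {p : N ⟶ Z}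
    {ε : Extension 𝒮.E Z A'} (hε : 𝒮.IsTriangle i p ε) (hp : pull 𝒮.E p δ = 0) :
    ∃ a : A' ⟶ A, push 𝒮.E a ε = δ := by
  obtain ⟨b, hb⟩ := (h.factorsThrough_iff p).2 hp
  obtain ⟨a, ha, -⟩ := 𝒮.et3_op _ _ _ _ hε h b (𝟙 Z) (by simp [hb])
  exact ⟨a, by rw [ha, pull_id]⟩

/-- If `y` is right minimal and right `D`-determined, then the extensions of `A` are detected
by `D`. -/
theorem IsTriangle.exists_pull_ne_zero (h : 𝒮.IsTriangle x y δ) (hmin : IsRightMinimal y) {D : C}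
    (hD : IsRightDetermined y D) {T : C} {ε : Extension 𝒮.E T A} (hε : ε ≠ 0) :
    ∃ e : D ⟶ T, pull 𝒮.E e ε ≠ 0 := by
  -- If `x_⋆ ε = 0`, exactness makes `ε` a pullback of `δ`, and determinedness applies directly.
  by_cases hx : push 𝒮.E x ε = 0
  · obtain ⟨g, rfl⟩ := h.exists_pull_eq hx
    by_contra! hcon
    refine hε ((h.factorsThrough_iff g).1 (hD g fun e => ?_))
    rw [h.factorsThrough_iff, pull_comp, hcon]
  · let γ : Extension 𝒮.E (Z ⊞ T) A := pull 𝒮.E biprod.fst δ + pull 𝒮.E biprod.snd ε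
    have hl : pull 𝒮.E biprod.inl γ = δ := by
      simp only [γ, map_add, ← pull_comp, biprod.inl_fst, biprod.inl_snd, pull_id, pull_zero,
        add_zero]
    have hr : pull 𝒮.E biprod.inr γ = ε := by
      simp only [γ, map_add, ← pull_comp, biprod.inr_fst, biprod.inr_snd, pull_id, pull_zero,
        zero_add]
    obtain ⟨N, i, p, hN⟩ := exists_isTriangle γ
    obtain ⟨b, hb, hb'⟩ := 𝒮.realization _ _ _ _ h hN (𝟙 A) biprod.inl (by rw [push_id, hl])
    have hb : x ≫ b = 𝟙 A ≫ i := hb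
    have hb' : y ≫ biprod.inl = b ≫ p := hb'
    have hnot : ¬ FactorsThrough (p ≫ biprod.fst) y := by
      rintro ⟨r, hr'⟩
      -- A lift `r` makes `b ≫ r` an endomorphism over `Z`, invertible by minimality. But `x ≫ b =
      -- i` kills `γ`, so `x_⋆ γ = 0`, contradicting `x_⋆ ε ≠ 0`.
      have hiso : IsIso (b ≫ r) := hmin _ (by
        rw [Category.assoc, hr', ← Category.assoc, ← hb', Category.assoc, biprod.inl_fst,
          Category.comp_id])
      have h0 : push 𝒮.E (b ≫ r) (push 𝒮.E x γ) = 0 := by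
        rw [push_comp, ← push_comp x b, hb, Category.id_comp, hN.push_eq_zero, map_zero]
      have h1 : push 𝒮.E x γ = 0 := by
        rw [← push_id (push 𝒮.E x γ), ← IsIso.hom_inv_id (b ≫ r), push_comp, h0, map_zero]
      exact hx (by rw [← hr, ← pull_push, h1, map_zero])
    by_contra! hcon
    refine hnot (hD _ fun e => ?_)
    rw [h.factorsThrough_iff]
    -- As `p^⋆ γ = 0` and `D` is assumed not to see `ε`, the `δ`-part of `e^⋆ p^⋆ γ` vanishes too.
    have h0 : pull 𝒮.E e (pull 𝒮.E p γ) = 0 := by rw [hN.pull_eq_zero, map_zero]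
    simp only [γ, map_add] at h0
    simpa only [← pull_comp, Category.assoc, hcon, add_zero] using h0

end Exactness

end Extriangulated
end Extri

/-! ### Almost split extensions from detection -/

namespace Extri
namespace Extriangulated

attribute [local instance] hasBinaryBiproducts_of_finite_biproducts

variable {k : Type u₀} [CommRing k] {C : Type u} [Category.{v} C] [Preadditive C]
  [Linear k C] [HasFiniteBiproducts C] (𝒮 : Extriangulated.{w} k C)

/-- Every nonzero extension of `A` has a nonzero pullback along some morphism from `D`. -/
def Detects (D A : C) : Prop :=
  ∀ ⦃T : C⦄ (ε : Extension 𝒮.E T A), ε ≠ 0 → ∃ e : D ⟶ T, pull 𝒮.E e ε ≠ 0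

variable {𝒮}

theorem Detects.of_retract {D A A' : C} (h : 𝒮.Detects D A) (i : A' ⟶ A) (r : A ⟶ A')
    (hir : i ≫ r = 𝟙 A') : 𝒮.Detects D A' := by
  intro T ε hε
  have h1 : push 𝒮.E i ε ≠ 0 := fun h0 => hε (by
    rw [← push_id ε, ← hir, push_comp, h0, map_zero])
  obtain ⟨e, he⟩ := h _ h1
  exact ⟨e, fun h0 => he (by rw [pull_push, h0, map_zero])⟩

/-- The deflation of `σ` is right almost split. -/
def IsRightAlmostSplit {Z A : C} (σ : Extension 𝒮.E Z A) : Prop :=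
  σ ≠ 0 ∧ ∀ ⦃T : C⦄ (g : T ⟶ Z), pull 𝒮.E g σ ≠ 0 → ∃ s : Z ⟶ T, s ≫ g = 𝟙 Z

/-- The map `e ↦ e^⋆ ε`. -/
def pullHom {T A : C} (D : C) (ε : Extension 𝒮.E T A) : (D ⟶ T) →ₗ[k] Extension 𝒮.E D A where
  toFun e := pull 𝒮.E e ε
  map_add' a b := 𝒮.pull_add a b ε
  map_smul' r a := 𝒮.pull_smul r a ε

theorem range_pullHom_pull_le {T' T A : C} (D : C) (g : T' ⟶ T) (ε : Extension 𝒮.E T A) :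
    LinearMap.range (pullHom D (pull 𝒮.E g ε)) ≤ LinearMap.range (pullHom D ε) := by
  rintro _ ⟨e, rfl⟩
  exact ⟨e ≫ g, pull_comp 𝒮 _ _ _⟩

/-- Choose `ε ≠ 0` whose pullbacks to `D` form a minimal submodule, and restrict a nonzero `e^⋆ ε`
to a local summand of `D`. If `g^⋆ σ ≠ 0` for the resulting `σ`, minimality recovers `e^⋆ ε` from
`g^⋆ σ`. This gives an endomorphism through `g` fixing `σ`, invertible by locality, so `g` is a
split epimorphism. -/
theorem Detects.exists_isRightAlmostSplit (hC : IsKrullSchmidt C) {D A : C} (hD : 𝒮.Detects D A)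
    [IsArtinian k (Extension 𝒮.E D A)] {T₀ : C} {ε₀ : Extension 𝒮.E T₀ A} (hε₀ : ε₀ ≠ 0) :
    ∃ (Z : C) (σ : Extension 𝒮.E Z A), IsRightAlmostSplit σ := by
  obtain ⟨N, ⟨T, ε, hε, rfl⟩, hmin⟩ := IsArtinian.set_has_minimal
    {N : Submodule k (Extension 𝒮.E D A) | ∃ (T : C) (ε : Extension 𝒮.E T A), ε ≠ 0 ∧
      LinearMap.range (pullHom D ε) = N} ⟨_, T₀, ε₀, hε₀, rfl⟩
  obtain ⟨e, he⟩ := hD ε hε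
  obtain ⟨n, Y, hY, ⟨φ⟩⟩ := hC D
  obtain ⟨i, hi⟩ : ∃ i, pull 𝒮.E (biproduct.ι Y i ≫ φ.inv) (pull 𝒮.E e ε) ≠ 0 := by
    by_contra! hcon
    refine he ?_
    rw [← 𝒮.pull_id (pull 𝒮.E e ε), ← sum_comp_of_iso_biproduct φ, pull_sum]
    refine Finset.sum_eq_zero fun i _ => ?_
    rw [pull_comp, hcon, map_zero]
  refine ⟨Y i, _, hi, fun T' g hg => ?_⟩
  have hle : LinearMap.range (pullHom D (pull 𝒮.E g (pull 𝒮.E (biproduct.ι Y i ≫ φ.inv)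
      (pull 𝒮.E e ε)))) ≤ LinearMap.range (pullHom D ε) :=
    (range_pullHom_pull_le _ _ _).trans ((range_pullHom_pull_le _ _ _).trans
      (range_pullHom_pull_le _ _ _))
  have heq := eq_of_le_of_not_lt hle (hmin _ ⟨T', _, hg, rfl⟩)
  obtain ⟨h, hh⟩ : pull 𝒮.E e ε ∈ LinearMap.range (pullHom D (pull 𝒮.E g
      (pull 𝒮.E (biproduct.ι Y i ≫ φ.inv) (pull 𝒮.E e ε)))) := heq ▸ ⟨e, rfl⟩
  replace hh : pull 𝒮.E h (pull 𝒮.E g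
      (pull 𝒮.E (biproduct.ι Y i ≫ φ.inv) (pull 𝒮.E e ε))) = pull 𝒮.E e ε := hh
  set σ := pull 𝒮.E (biproduct.ι Y i ≫ φ.inv) (pull 𝒮.E e ε) with hσ
  let t := ((biproduct.ι Y i ≫ φ.inv) ≫ h) ≫ g
  have ht : pull 𝒮.E t σ = σ := by rw [pull_comp, pull_comp, hh]
  have := hY i
  have hiso : IsIso t := by
    refine (isIso_or_isIso_of_add_eq_id t (𝟙 _ - t) (by abel)).resolve_right fun hi' => hi ?_
    rw [← 𝒮.pull_id σ, ← IsIso.inv_hom_id (𝟙 _ - t), pull_comp, pull_sub, pull_id, ht, sub_self,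
      map_zero]
  exact ⟨inv t ≫ (biproduct.ι Y i ≫ φ.inv) ≫ h, by
    rw [Category.assoc]; exact IsIso.inv_hom_id t⟩

/-- The deflation of a nonzero `ε` is not split, so it pulls `σ` back to zero. -/
theorem IsRightAlmostSplit.exists_push_eq {Z A A' : C} {σ : Extension 𝒮.E Z A}
    (hσ : IsRightAlmostSplit σ) {ε : Extension 𝒮.E Z A'} (hε : ε ≠ 0) :
    ∃ a : A' ⟶ A, push 𝒮.E a ε = σ := by
  obtain ⟨B, x, y, hy⟩ := exists_isTriangle σ
  obtain ⟨N, i, p, hp⟩ := exists_isTriangle ε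
  refine hy.exists_push_eq hp ?_
  by_contra hne
  obtain ⟨s, hs⟩ := hσ.2 p hne
  exact hε (by rw [← 𝒮.pull_id ε, ← hs, pull_comp, hp.pull_eq_zero, map_zero])

/-- The left almost split property: pushing back to `σ` gives an endomorphism of `A` fixing `σ`,
which locality makes invertible. -/
theorem IsRightAlmostSplit.exists_comp_eq_id {Z A A' : C} [IsLocalRing (End A)]
    {σ : Extension 𝒮.E Z A} (hσ : IsRightAlmostSplit σ) (a : A ⟶ A')
    (ha : push 𝒮.E a σ ≠ 0) : ∃ r : A' ⟶ A, a ≫ r = 𝟙 A := by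
  obtain ⟨b, hb⟩ := hσ.exists_push_eq ha
  rw [← push_comp] at hb
  have : IsIso (a ≫ b) := by
    refine (isIso_or_isIso_of_add_eq_id (a ≫ b) (𝟙 _ - a ≫ b) (by abel)).resolve_right
      fun hi => hσ.1 ?_
    rw [← push_id σ, ← IsIso.hom_inv_id (𝟙 _ - a ≫ b), push_comp, push_sub, push_id, hb, sub_self,
      map_zero]
  exact ⟨b ≫ inv (a ≫ b), by rw [← Category.assoc, IsIso.hom_inv_id]⟩

theorem IsRightAlmostSplit.exists_pull_eq {Z A T : C} [IsLocalRing (End A)]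
    {σ : Extension 𝒮.E Z A} (hσ : IsRightAlmostSplit σ) {ε : Extension 𝒮.E T A} (hε : ε ≠ 0) :
    ∃ g : Z ⟶ T, pull 𝒮.E g ε = σ := by
  obtain ⟨N, i, p, hi⟩ := exists_isTriangle ε
  refine hi.exists_pull_eq ?_
  by_contra hne
  obtain ⟨r, hr⟩ := hσ.exists_comp_eq_id i hne
  exact hε (by rw [← push_id ε, ← hr, push_comp, hi.push_eq_zero, map_zero])

/-! ### Universal functionals and representability -/

/-- The functional `η` on `𝔼(W, A)` is a universal element of `D𝔼(-, A)` over the stable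
category. -/
structure IsUniversal {W A : C}
    (η : Extension 𝒮.E W A →ₗ[k] minimalInjectiveCogenerator k) : Prop where
  surjective : ∀ ⦃T : C⦄ (φ : Extension 𝒮.E T A →ₗ[k] minimalInjectiveCogenerator k),
    ∃ g : W ⟶ T, η ∘ₗ pull 𝒮.E g = φ
  injective : ∀ ⦃T : C⦄ (g : W ⟶ T), η ∘ₗ pull 𝒮.E g = 0 → 𝒮.IsProjMor g

/-- Every nonzero extension of `A` pulls back to `σ`, so the functionals `η ∘ g^⋆` separate `𝔼(T,
A)` and exhaust its dual by finite length. Every nonzero `g^⋆ δ` pushes forward to `σ`, so `η ∘ g^⋆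
= 0` only for `𝔰`-projective `g`. -/
theorem IsRightAlmostSplit.isUniversal [IsArtinianRing k] (hExt : 𝒮.IsExtFinite) {Z A : C}
    [IsLocalRing (End A)] {σ : Extension 𝒮.E Z A} (hσ : IsRightAlmostSplit σ)
    {η : Extension 𝒮.E Z A →ₗ[k] minimalInjectiveCogenerator k} (hη : η σ ≠ 0) :
    IsUniversal η where
  surjective T φ := by
    let Φ : (Z ⟶ T) →ₗ[k] (Extension 𝒮.E T A →ₗ[k] minimalInjectiveCogenerator k) :=
      { toFun := fun g => η ∘ₗ pull 𝒮.E g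
        map_add' := fun a b => LinearMap.ext fun δ => by
          simp only [LinearMap.comp_apply, LinearMap.add_apply, 𝒮.pull_add, map_add]
        map_smul' := fun r a => LinearMap.ext fun δ => by
          simp only [LinearMap.comp_apply, LinearMap.smul_apply, 𝒮.pull_smul, map_smul,
            RingHom.id_apply] }
    have := hExt T A
    have htop : LinearMap.range Φ = ⊤ := by
      refine (minimalInjectiveCogenerator_spec k).eq_top_of_annihilator_eq_bot
        (isFiniteLength_iff_isNoetherian_isArtinian.2 ⟨inferInstance, inferInstance⟩) _
        fun ε hε => ?_
      by_contra hne
      obtain ⟨g, hg⟩ := hσ.exists_pull_eq hne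
      exact hη (hg ▸ hε (Φ g) ⟨g, rfl⟩)
    exact LinearMap.range_eq_top.1 htop φ
  injective T g hg A' δ := by
    by_contra hne
    obtain ⟨a, ha⟩ := hσ.exists_push_eq hne
    rw [← pull_push] at ha
    exact hη (ha ▸ DFunLike.congr_fun hg (push 𝒮.E a δ))

theorem isUniversal_of_subsingleton {W A : C} (hA : ∀ T, Subsingleton (Extension 𝒮.E T A))
    (hW : 𝟙 W = 0) (η : Extension 𝒮.E W A →ₗ[k] minimalInjectiveCogenerator k) :
    IsUniversal η where
  surjective T φ := ⟨0, LinearMap.ext fun δ => by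
    have := hA T
    rw [Subsingleton.elim δ 0, map_zero, map_zero]⟩
  injective T g _ A' δ := by
    rw [← Category.id_comp g, hW, zero_comp, pull_zero]

theorem Detects.exists_isUniversal_of_isLocalRing [IsArtinianRing k] (hExt : 𝒮.IsExtFinite)
    (hC : IsKrullSchmidt C) {D A : C} [IsLocalRing (End A)] (hD : 𝒮.Detects D A) :
    ∃ (W : C) (η : Extension 𝒮.E W A →ₗ[k] minimalInjectiveCogenerator k), IsUniversal η := by
  -- With no nonzero extension of `A` there is no almost split one; the functor is zero and a zero
  -- object represents it.
  by_cases hA : ∀ T, Subsingleton (Extension 𝒮.E T A)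
  · exact ⟨⨁ (fun i : Fin 0 => i.elim0 : Fin 0 → C), 0,
      isUniversal_of_subsingleton hA (biproduct.hom_ext' _ _ fun i => i.elim0) 0⟩
  · push Not at hA
    obtain ⟨T, hT⟩ := hA
    obtain ⟨ε, hε⟩ := exists_ne (0 : Extension 𝒮.E T A)
    have := hExt D A
    obtain ⟨Z, σ, hσ⟩ := hD.exists_isRightAlmostSplit hC hε
    have := hExt Z A
    obtain ⟨η, hη⟩ := (minimalInjectiveCogenerator_spec k).exists_apply_ne_zero hσ.1
    exact ⟨Z, η, hσ.isUniversal hExt hη⟩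

/-- The functor `D𝔼(-, A)` is additive in `A`; the universal functional on `⨁ W` is the sum of the
diagonal ones. -/
theorem exists_isUniversal_of_iso_biproduct {n : ℕ} {A : C} {Y : Fin n → C} (φ : A ≅ ⨁ Y)
    (hY : ∀ i, ∃ (W : C) (η : Extension 𝒮.E W (Y i) →ₗ[k] minimalInjectiveCogenerator k),
      IsUniversal η) :
    ∃ (W : C) (η : Extension 𝒮.E W A →ₗ[k] minimalInjectiveCogenerator k), IsUniversal η := by
  classical
  choose W η hη using hY
  let p : ∀ i, A ⟶ Y i := fun i => φ.hom ≫ biproduct.π Y i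
  let q : ∀ i, Y i ⟶ A := fun i => biproduct.ι Y i ≫ φ.inv
  have hpq : ∑ i, p i ≫ q i = 𝟙 A :=
    sum_comp_of_iso_biproduct φ
  have hqp : ∀ i, q i ≫ p i = 𝟙 _ := fun i => by simp [p, q]
  have hqp' : ∀ i j, i ≠ j → q i ≫ p j = 0 := fun i j hij => by
    simp [p, q, biproduct.ι_π_ne Y hij]
  let θ : Extension 𝒮.E (⨁ W) A →ₗ[k] minimalInjectiveCogenerator k :=
    ∑ i, η i ∘ₗ pull 𝒮.E (biproduct.ι W i) ∘ₗ push 𝒮.E (p i)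
  have hθ : ∀ {T : C} (g : (⨁ W) ⟶ T) (ε : Extension 𝒮.E T A),
      θ (pull 𝒮.E g ε) =
        ∑ i, (η i ∘ₗ pull 𝒮.E (biproduct.ι W i ≫ g)) (push 𝒮.E (p i) ε) := by
    intro T g ε
    simp only [θ, LinearMap.sum_apply, LinearMap.comp_apply, pull_comp, pull_push]
  refine ⟨⨁ W, θ, ⟨fun T ψ => ?_, fun T g hg A' δ => ?_⟩⟩
  · choose g hg using fun i => (hη i).surjective (ψ ∘ₗ push 𝒮.E (q i))
    refine ⟨biproduct.desc g, LinearMap.ext fun ε => ?_⟩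
    rw [LinearMap.comp_apply, hθ]
    simp only [biproduct.ι_desc, hg, LinearMap.comp_apply, ← push_comp]
    rw [← map_sum, ← push_sum, hpq, push_id]
  · have hi : ∀ i, 𝒮.IsProjMor (biproduct.ι W i ≫ g) := by
      intro i
      refine (hη i).injective _ (LinearMap.ext fun ε => ?_)
      have h0 : θ (pull 𝒮.E g (push 𝒮.E (q i) ε)) = 0 := DFunLike.congr_fun hg _
      rw [hθ, Finset.sum_eq_single i] at h0
      · rwa [← push_comp, hqp, push_id] at h0
      · intro j _ hj
        rw [← push_comp, hqp' i j hj.symm, push_zero, map_zero]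
      · simp
    have hg' : g = ∑ i, biproduct.π W i ≫ biproduct.ι W i ≫ g := by
      calc g = (∑ i, biproduct.π W i ≫ biproduct.ι W i) ≫ g := by
            rw [biproduct.total, Category.id_comp]
        _ = _ := by simp only [Preadditive.sum_comp, Category.assoc]
    rw [hg', pull_sum]
    refine Finset.sum_eq_zero fun i _ => ?_
    rw [pull_comp, hi i, map_zero]

theorem Detects.exists_isUniversal [IsArtinianRing k] (hExt : 𝒮.IsExtFinite)
    (hC : IsKrullSchmidt C) {D A : C} (hD : 𝒮.Detects D A) :
    ∃ (W : C) (η : Extension 𝒮.E W A →ₗ[k] minimalInjectiveCogenerator k), IsUniversal η := by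
  obtain ⟨n, Y, hY, ⟨φ⟩⟩ := hC A
  refine exists_isUniversal_of_iso_biproduct φ fun i => ?_
  have := hY i
  exact (hD.of_retract (biproduct.ι Y i ≫ φ.inv) (φ.hom ≫ biproduct.π Y i)
    (by simp)).exists_isUniversal_of_isLocalRing hExt hC

theorem IsTriangle.isRightDetermined (hExt : 𝒮.IsExtFinite) {A B Z W : C} {x : A ⟶ B}
    {y : B ⟶ Z} {δ : Extension 𝒮.E Z A} (h : 𝒮.IsTriangle x y δ)
    {η : Extension 𝒮.E W A →ₗ[k] minimalInjectiveCogenerator k} (hη : IsUniversal η) :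
    IsRightDetermined y W := by
  intro T g hg
  rw [h.factorsThrough_iff]
  by_contra hne
  have := hExt T A
  obtain ⟨φ, hφ⟩ := (minimalInjectiveCogenerator_spec k).exists_apply_ne_zero hne
  obtain ⟨e, rfl⟩ := hη.surjective φ
  refine hφ ?_
  rw [LinearMap.comp_apply, ← pull_comp, (h.factorsThrough_iff _).1 (hg e), map_zero]

/-- Yoneda's lemma: a representation is determined by the image `η` of the identity, and equality in
the stable category means that the difference is `𝔰`-projective. -/
theorem memCl_iff {A : C} : 𝒮.MemCl A ↔
    ∃ (W : C) (η : Extension 𝒮.E W A →ₗ[k] minimalInjectiveCogenerator k), IsUniversal η := by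
  constructor
  · rintro ⟨W, ⟨r⟩⟩
    let η : Extension 𝒮.E W.as A →ₗ[k] minimalInjectiveCogenerator k := r.homEquiv (𝟙 W)
    have hr : ∀ {T : C} (g : W.as ⟶ T), r.homEquiv ((Quotient.functor 𝒮.stableRel).map g) =
        η ∘ₗ pull 𝒮.E g := fun g => r.homEquiv_eq _
    refine ⟨W.as, η, ⟨fun T φ => ?_, fun T g hg => ?_⟩⟩
    · obtain ⟨g, hg⟩ := (Quotient.functor 𝒮.stableRel).map_surjective
        (r.homEquiv.symm φ : W ⟶ (Quotient.functor 𝒮.stableRel).obj T)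
      refine ⟨g, ?_⟩
      exact (hr g).symm.trans ((congrArg r.homEquiv hg).trans (r.homEquiv.apply_symm_apply φ))
    · have h0 : r.homEquiv ((Quotient.functor 𝒮.stableRel).map g) =
          r.homEquiv ((Quotient.functor 𝒮.stableRel).map (0 : W.as ⟶ T)) := by
        rw [hr, hr, hg]
        refine LinearMap.ext fun δ => ?_
        rw [LinearMap.comp_apply, pull_zero, map_zero, LinearMap.zero_apply]
      have h1 := (Quotient.functor_map_eq_iff 𝒮.stableRel _ _).1 (r.homEquiv.injective h0)
      simpa [stableRel] using h1
  · rintro ⟨W, η, hη⟩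
    let F := 𝒮.stableDualExt A ⋙ forget (ModuleCat.{max w u₀} k)
    let Q := Quotient.functor 𝒮.stableRel
    let τ : ∀ T : 𝒮.StableCategory, (Q.obj W ⟶ T) → F.obj T := fun T f => F.map f η
    have hτ : ∀ {T : C} (g : W ⟶ T), τ (Q.obj T) (Q.map g) = η ∘ₗ pull 𝒮.E g := fun g => rfl
    have hbij : ∀ T, Function.Bijective (τ T) := by
      rintro ⟨T⟩
      constructor
      · intro f f' hff
        obtain ⟨g, rfl⟩ := Q.map_surjective (X := W) (Y := T) f
        obtain ⟨g', rfl⟩ := Q.map_surjective (X := W) (Y := T) f'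
        refine (Quotient.functor_map_eq_iff 𝒮.stableRel _ _).2
          (hη.injective (g - g') (LinearMap.ext fun δ => ?_))
        have h1 : η ∘ₗ pull 𝒮.E g = η ∘ₗ pull 𝒮.E g' := (hτ g).symm.trans (hff.trans (hτ g'))
        rw [LinearMap.comp_apply, pull_sub, map_sub, LinearMap.zero_apply, sub_eq_zero]
        exact DFunLike.congr_fun h1 δ
      · intro φ
        obtain ⟨g, hg⟩ := hη.surjective φ
        exact ⟨Q.map g, (hτ g).trans hg⟩
    exact ⟨Q.obj W, ⟨{
      homEquiv := fun {T} => Equiv.ofBijective (τ T) (hbij T)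
      homEquiv_comp := fun g f => by
        change F.map (f ≫ g) η = F.map g (F.map f η)
        rw [F.map_comp]; rfl }⟩⟩

end Extriangulated
end Extri

theorem theorem4p8 {k : Type u₀} [CommRing k] [IsArtinianRing k]
    {C : Type u} [Category.{v} C] [Preadditive C] [Linear k C] [HasFiniteBiproducts C]
    (𝒮 : Extri.Extriangulated.{w} k C) (hExt : 𝒮.IsExtFinite) (hKS : Extri.IsKrullSchmidt C)
    (hWIC : 𝒮.WIC) {X Y : C} (α : X ⟶ Y) (hα : 𝒮.IsDeflation α) :
    (∃ K : C, 𝒮.IsIntrinsicWeakKernel α K) ∧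
    ∀ K : C, 𝒮.IsIntrinsicWeakKernel α K →
      ((∃ D : C, Extri.IsRightDetermined α D) ↔ 𝒮.MemCl K) := by
  constructor
  · obtain ⟨X', f', hf'⟩ := hKS.exists_isRightMinimalVersion α
    obtain ⟨e, he⟩ := hf'.2.1
    -- Since `α = e ≫ f'` is a deflation, WIC makes `f'` one.
    obtain ⟨K, x, δ, hδ⟩ := hWIC.deflation e f' (he ▸ hα)
    exact ⟨K, X', f', x, δ, hf', hδ⟩
  · rintro K ⟨X', f', x, δ, hf', hδ⟩
    simp_rw [hf'.2.isRightDetermined_iff, Extri.Extriangulated.memCl_iff]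
    constructor
    · rintro ⟨D, hD⟩
      have hdet : 𝒮.Detects D K := fun T ε hε => hδ.exists_pull_ne_zero hf'.1 hD hε
      exact hdet.exists_isUniversal hExt hKS
    · rintro ⟨W, η, hη⟩
      exact ⟨W, hδ.isRightDetermined hExt hη⟩
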